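/- \textbf{Setting.} There are $N$ servers and a totally ordered set $C$ of clients in an asynchronous message-passing system with reliable channels (unbounded delays, arbitrary reordering). Let $K$ be a finite field, $\alpha_1,\dots,\alpha_N\in K$ pairwise distinct, $k\ge 1$, $e,f\ge 0$. The $(N,k)$ Reed--Solomon code $\Phi$ maps $m=(\sigma_1,\dots,\sigma_k)\in K^k$ to the shares $\Phi_i(m)=\sum_{j=1}^{k}\sigma_j\alpha_i^{j-1}$, $1\le i\le N$; the secret of $m$ is $\sigma_1$. Tags are the default tag $t_0$ and the pairs in $\mathbb{Z}^+\times C$, ordered lexicographically with $t_0$ below all of them. A quorum is a set of at least $\lceil (N+k+2e)/2\rceil$ servers. \textbf{Algorithm.} Each server stores records (tag, share or $\bot$, label `pre' or `fin'), initially $(t_0,\Phi_i(m_0),\text{`fin'})$. In a quorum access a client sends a request to all servers and waits for replies to it from a quorum. A \emph{write} of a secret $s$ encodes some $m\in K^k$ with first coordinate $s$ and makes three accesses: a query for the highest finalized tags (with maximum of integer part $z$, where $z=0$ for $t_0$), a pre-write of share $\Phi_i(m)$ with the new tag $(z+1,\text{client})$ at each server $i$, and a finalize request for that tag. A \emph{read}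 makes two accesses: a query, giving the maximal tag $t$, and a finalize request for $t$, to which servers reply with their share of tag $t$ or $\bot$. If at least $k+2e$ replies hold shares, the read applies the Berlekamp--Welch decoder for $e$ errors to them and returns the secret of the result; otherwise it returns $\bot$. A server stores a pre-written share unless it already has a record of that tag; on a finalize request it labels its record of that tag `fin' (or adds $(t,\bot,\text{`fin'})$) and gossips the tag to all other servers, which do the same labelling. Each client invokes its operations one after the other. \textbf{Faults.} Crashed processes stop; any number of clients may crash. Malicious servers follow the algorithm except that in their replies to clients they may put arbitrary field elements in place of the shares (or of $\bot$); they do not alter tags or labels, and do not withhold shares. An execution is fair if every message between processes that never crash is eventually delivered and every client that never crashes continues its operation after hearing from a quorum. The algorithm is \emph{$(s,t)$-robust} if in every execution with at most $s$ crashed servers and at most $t$ malicious servers (i) every finite prefix of the history of operations is linearizable with respect to a read/write register whose initial value is the secret of $m_0$ and (ii) if the execution is fair, every operation of a client that never crashes returns. \textbf{Lemma.} For every $k\in\{1,\dots,N-2(f+e)\}$ and every $m_0\in K^k$ the algorithm is $(f,e)$-robust. Moreover, in every execution with at most $f$ crashed and at most $e$ malicious servers, whenever a read returns, the tag $t$ that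 it selected is either $t_0$ (then put $m:=m_0$) or the tag of a write, of some vector $m$, that reached its finalize phase before; the read has received at least $k+2e$ shares of tag $t$, at most $e$ of them different from the corresponding share of $m$; the Berlekamp--Welch decoder applied to these shares outputs $m$; and the read returns the secret of $m$. -/

import Mathlib

namespace CAS

open Polynomial

/-! ### Reed–Solomon codes and Berlekamp–Welch decoding -/

section Coding

variable {N : ℕ} {K : Type*} [Field K]

/-- The `(N,k)` Reed–Solomon code with evaluation points `α`: the message
`m = (σ₁, …, σ_k)` is read as the polynomial `σ₁ + σ₂ X + ⋯ + σ_k X^(k-1)` and the `i`-th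
coded element (share) is its value at `α i`. -/
def encode (α : Fin N → K) {k : ℕ} (m : Fin k → K) (i : Fin N) : K :=
  ∑ j : Fin k, m j * α i ^ (j : ℕ)

/-- The secret carried by a message vector is its first coordinate; the others are padding
(randomly chosen by the writer). -/
def secret {k : ℕ} [NeZero k] (m : Fin k → K) : K := m 0

/-- The key equations of the Berlekamp–Welch algorithm for received values `y`
(`none` marks an erasure) and at most `e` errors: a non-zero error locator `E` of degree at
most `e` and a polynomial `Q` of degree less than `k + e` such that `Q(αᵢ) = yᵢ E(αᵢ)` for
every received `yᵢ`. -/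
def IsKeySolution (α : Fin N → K) (k e : ℕ) (y : Fin N → Option K) (EQ : K[X] × K[X]) : Prop :=
  EQ.1 ≠ 0 ∧ EQ.1.natDegree ≤ e ∧ EQ.2.degree < ((k + e : ℕ) : WithBot ℕ) ∧
    ∀ i w, y i = some w → EQ.2.eval (α i) = w * EQ.1.eval (α i)

open Classical in
/-- The Berlekamp–Welch decoder: take some solution `(E, Q)` of the key equations and, if `E`
divides `Q`, output the coefficients of `Q / E`; otherwise report a failure. -/
noncomputable def berlekampWelch (α : Fin N → K) (k e : ℕ) (y : Fin N → Option K) :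
    Option (Fin k → K) :=
  if h : ∃ EQ, IsKeySolution α k e y EQ then
    if h.choose.1 ∣ h.choose.2 then some fun j => (h.choose.2 / h.choose.1).coeff (j : ℕ)
    else none
  else none

open Classical in
/-- The number of received values. -/
noncomputable def numReceived (y : Fin N → Option K) : ℕ :=
  (Finset.univ.filter fun i => y i ≠ none).card

open Classical in
/-- The number of received values that differ from the coded elements of `m`. -/
noncomputable def numCorrupted (α : Fin N → K) {k : ℕ} (m : Fin k → K) (y : Fin N → Option K) : ℕ :=
  (Finset.univ.filter fun i => y i ≠ none ∧ y i ≠ some (encode α m i)).card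

end Coding

/-! ### Tags, records and messages -/

/-- Tags: pairs of a positive integer and a client identifier in lexicographic order, together
with the default tag `t₀ = ⊥` below all of them. -/
abbrev Tag (C : Type*) := WithBot (ℕ+ ×ₗ C)

/-- The integer part of a tag (`0` for the default tag). -/
def Tag.num {C : Type*} (t : Tag C) : ℕ :=
  WithBot.recBotCoe (C := fun _ => ℕ) 0 (fun x => ((ofLex x).1 : ℕ)) t

/-- The tag `(z + 1, c)`, where `z` is the integer part of `t`. -/
def Tag.next {C : Type*} (t : Tag C) (c : C) : Tag C :=
  ((toLex (Nat.succPNat (Tag.num t), c) : ℕ+ ×ₗ C) : Tag C)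

/-- The labels of records and messages (the records of a server only use `pre` and `fin`). -/
inductive Label where
  | qry
  | pre
  | fin

/-- A triple `(t, w, d)` of a tag, a coded element or `⊥` (`none`), and a label. It serves as a
record in the storage of a server and as the content of a reply to a client. -/
structure Rec (K C : Type*) where
  tag : Tag C
  data : Option K
  label : Label

/-- The requests of clients: a query, the pre-write of a coded element, a finalize request of a
writer and a finalize request of a reader. -/
inductive Request (K C : Type*) where
  | qry
  | pre (t : Tag C) (w : K)
  | finW (t : Tag C)
  | finR (t : Tag C)

/-- Messages. A request carries the running number of the quorum access to which it belongs;
the reply repeats that number, so that a client can tell replies to its current access from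
late ones. -/
inductive Msg (N : ℕ) (K C : Type*) where
  | request (c : C) (i : Fin N) (seq : ℕ) (r : Request K C)
  | reply (i : Fin N) (c : C) (seq : ℕ) (r : Rec K C)
  | gossip (i j : Fin N) (t : Tag C)

/-- Servers and clients. -/
abbrev Proc (N : ℕ) (C : Type*) := Fin N ⊕ C

/-- The sender of a message. -/
def Msg.src {N : ℕ} {K C : Type*} : Msg N K C → Proc N C
  | .request c _ _ _ => .inr c
  | .reply i _ _ _ => .inl i
  | .gossip i _ _ => .inl i

/-- The receiver of a message. -/
def Msg.dst {N : ℕ} {K C : Type*} : Msg N K C → Proc N C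
  | .request _ i _ _ => .inl i
  | .reply _ c _ _ => .inr c
  | .gossip _ j _ => .inl j

/-! ### The server -/

section Server

variable {N : ℕ} {K C : Type*} [LinearOrder C]

open Classical in
/-- The highest tag of a record labelled `fin` (the default tag if there is none). -/
noncomputable def maxFin (S : Finset (Rec K C)) : Tag C :=
  (S.filter fun r => r.label = Label.fin).sup Rec.tag

open Classical in
/-- Relabel every record with tag `t` as `fin`. -/
noncomputable def relabel (S : Finset (Rec K C)) (t : Tag C) : Finset (Rec K C) :=
  S.image fun r => if r.tag = t then { r with label := Label.fin } else r

open Classical in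
/-- The coded element with tag `t` in the storage, if there is one. -/
noncomputable def storedShare (S : Finset (Rec K C)) (t : Tag C) : Option K :=
  if h : ∃ w : K, ∃ d, Rec.mk t (some w) d ∈ S then some h.choose else none

open Classical in
/-- The new storage of a server after a request. -/
noncomputable def storageAfter (S : Finset (Rec K C)) : Request K C → Finset (Rec K C)
  | .qry => S
  | .pre t w => if ∃ r ∈ S, r.tag = t then S else insert ⟨t, some w, .pre⟩ S
  | .finW t =>
      if ∃ w, Rec.mk t w .pre ∈ S then relabel S t else insert ⟨t, none, .fin⟩ S
  | .finR t =>
      if ∃ w : K, ∃ d, Rec.mk t (some w) d ∈ S then relabel S t else insert ⟨t, none, .fin⟩ S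

/-- The reply of a correct server with storage `S` to a request. -/
noncomputable def correctReply (S : Finset (Rec K C)) : Request K C → Rec K C
  | .qry => ⟨maxFin S, none, .qry⟩
  | .pre t w => ⟨t, some w, .pre⟩
  | .finW t => ⟨t, none, .fin⟩
  | .finR t => ⟨t, storedShare S t, .fin⟩

/-- What a malicious server may send in place of the correct reply `r`: tag and label are
unchanged, and a coded element may be replaced by any field element. (It may also make up a
coded element where there is none; it does not withhold one.) -/
def Corruption (r r' : Rec K C) : Prop :=
  r'.tag = r.tag ∧ r'.label = r.label ∧ (r.data ≠ none → r'.data ≠ none)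

/-- The gossip messages of server `i` after a request. -/
def gossipAfter (i : Fin N) : Request K C → Multiset (Msg N K C)
  | .qry => 0
  | .pre _ _ => 0
  | .finW t => (Finset.univ.erase i).val.map fun j => .gossip i j t
  | .finR t => (Finset.univ.erase i).val.map fun j => .gossip i j t

open Classical in
/-- The new storage of a server after the arrival of the gossip message `t`. -/
noncomputable def storageAfterGossip (S : Finset (Rec K C)) (t : Tag C) : Finset (Rec K C) :=
  if ∃ r ∈ S, r.tag = t then relabel S t else insert ⟨t, none, .fin⟩ S

end Server

/-! ### The client -/

/-- Where a client is in its procedure: not in an operation; in the query, pre-write or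
finalize phase of a write; in the query or finalize phase of a read. -/
inductive Phase (k : ℕ) (K C : Type*) where
  | idle
  | wQry (m : Fin k → K)
  | wPre (m : Fin k → K) (t : Tag C)
  | wFin (m : Fin k → K) (t : Tag C)
  | rQry
  | rFin (t : Tag C)

/-- The state of a client: its phase, the number of its latest quorum access, and the replies to
that access that have arrived so far. -/
structure Client (N k : ℕ) (K C : Type*) where
  phase : Phase k K C
  seq : ℕ
  replies : Fin N → Option (Rec K C)

/-- The size `⌈(N + k + 2e) / 2⌉` from which on a set of servers is a quorum. -/
def quorumSize (N k e : ℕ) : ℕ := ⌈((N + k + 2 * e : ℕ) : ℚ) / 2⌉₊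

section Client

variable {N k : ℕ} {K C : Type*}

open Classical in
/-- A quorum of servers has replied to the current access. -/
def Client.HasQuorum (e : ℕ) (cl : Client N k K C) : Prop :=
  quorumSize N k e ≤ (Finset.univ.filter fun i => cl.replies i ≠ none).card

/-- The maximal tag in the replies. -/
def Client.maxTag [LinearOrder C] (cl : Client N k K C) : Tag C :=
  Finset.univ.sup fun i => (cl.replies i).elim ⊥ Rec.tag

open Classical in
/-- The coded elements with tag `t` and label `fin` in the replies, by server. -/
noncomputable def Client.shares (cl : Client N k K C) (t : Tag C) (i : Fin N) : Option K :=
  (cl.replies i).bind fun r => if r.tag = t ∧ r.label = Label.fin then r.data else none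

/-- The result of a read of tag `t`: if at least `k + 2e` replies hold a coded element, the
secret in the output of the decoder; otherwise `⊥`. -/
noncomputable def Client.readResult [Field K] [NeZero k] (α : Fin N → K) (e : ℕ)
    (cl : Client N k K C) (t : Tag C) : Option K :=
  if k + 2 * e ≤ numReceived (cl.shares t) then
    (berlekampWelch α k e (cl.shares t)).map secret
  else none

end Client

/-! ### The system -/

/-- A state of the system: storages, clients, messages in transit, crashed processes. -/
structure State (N k : ℕ) (K C : Type*) where
  storage : Fin N → Finset (Rec K C)
  client : C → Client N k K C
  net : Multiset (Msg N K C)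
  crashed : Set (Proc N C)

/-- The atomic actions: nothing; the invocation of a write (of a message vector whose first
coordinate is the value written) or of a read; the delivery of a message; the passage of a
client to its next phase; the return of a write or of a read; a crash. -/
inductive Action (N k : ℕ) (K C : Type*) where
  | idle
  | invWrite (c : C) (m : Fin k → K)
  | invRead (c : C)
  | deliver (msg : Msg N K C)
  | advance (c : C)
  | retWrite (c : C)
  | retRead (c : C) (v : Option K)
  | crash (p : Proc N C)

section System

variable {N k : ℕ} {K C : Type*} [Field K] [LinearOrder C]

/-- The initial state for the initial message vector `m₀`. -/
def initState (α : Fin N → K) (m₀ : Fin k → K) : State N k K C where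
  storage i := {⟨⊥, some (encode α m₀ i), .fin⟩}
  client _ := ⟨.idle, 0, fun _ => none⟩
  net := 0
  crashed := ∅

/-- Client `c` enters phase `ph` and starts a quorum access by sending `req i` to every
server `i`. -/
def State.access (s : State N k K C) (c : C) (ph : Phase k K C) (req : Fin N → Request K C) :
    State N k K C :=
  { s with
    client := Function.update s.client c ⟨ph, (s.client c).seq + 1, fun _ => none⟩
    net := s.net +
      Finset.univ.val.map fun i => Msg.request c i ((s.client c).seq + 1) (req i) }

/-- Client `c` ends its operation. -/
def State.finish (s : State N k K C) (c : C) : State N k K C :=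
  { s with client := Function.update s.client c ⟨.idle, (s.client c).seq, fun _ => none⟩ }

/-- Client `c` receives reply `r` of server `i` to access number `q`; it ignores replies to
earlier accesses. -/
def State.receive (s : State N k K C) (i : Fin N) (c : C) (q : ℕ) (r : Rec K C) : State N k K C :=
  { s with
    client := Function.update s.client c
      (if q = (s.client c).seq then
        { s.client c with replies := Function.update (s.client c).replies i (some r) }
      else s.client c) }

/-- The steps of the algorithm with `(k + 2e)`-overlap quorums when the servers in `M` are
malicious. -/
inductive Step [NeZero k] (α : Fin N → K) (e : ℕ) (M : Finset (Fin N)) :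
    State N k K C → Action N k K C → State N k K C → Prop
  | idle (s) : Step α e M s .idle s
  | crash (s p) : Step α e M s (.crash p) { s with crashed := insert p s.crashed }
  | invWrite (s c m) (hc : .inr c ∉ s.crashed) (hp : (s.client c).phase = .idle) :
      Step α e M s (.invWrite c m) (s.access c (.wQry m) fun _ => .qry)
  | invRead (s c) (hc : .inr c ∉ s.crashed) (hp : (s.client c).phase = .idle) :
      Step α e M s (.invRead c) (s.access c .rQry fun _ => .qry)
  | preWrite (s c m) (hc : .inr c ∉ s.crashed) (hp : (s.client c).phase = .wQry m)
      (hq : (s.client c).HasQuorum e) :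
      Step α e M s (.advance c)
        (s.access c (.wPre m ((s.client c).maxTag.next c))
          fun i => .pre ((s.client c).maxTag.next c) (encode α m i))
  | finalizeWrite (s c m t) (hc : .inr c ∉ s.crashed) (hp : (s.client c).phase = .wPre m t)
      (hq : (s.client c).HasQuorum e) :
      Step α e M s (.advance c) (s.access c (.wFin m t) fun _ => .finW t)
  | retWrite (s c m t) (hc : .inr c ∉ s.crashed) (hp : (s.client c).phase = .wFin m t)
      (hq : (s.client c).HasQuorum e) :
      Step α e M s (.retWrite c) (s.finish c)
  | finalizeRead (s c) (hc : .inr c ∉ s.crashed) (hp : (s.client c).phase = .rQry)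
      (hq : (s.client c).HasQuorum e) :
      Step α e M s (.advance c)
        (s.access c (.rFin (s.client c).maxTag) fun _ => .finR (s.client c).maxTag)
  | retRead (s c t) (hc : .inr c ∉ s.crashed) (hp : (s.client c).phase = .rFin t)
      (hq : (s.client c).HasQuorum e) :
      Step α e M s (.retRead c ((s.client c).readResult α e t)) (s.finish c)
  | request (s c i q req rest r) (hi : .inl i ∉ s.crashed)
      (hnet : s.net = Msg.request c i q req ::ₘ rest)
      (hr : r = correctReply (s.storage i) req ∨
        i ∈ M ∧ Corruption (correctReply (s.storage i) req) r) :
      Step α e M s (.deliver (.request c i q req))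
        { s with
          storage := Function.update s.storage i (storageAfter (s.storage i) req)
          net := rest + (Msg.reply i c q r ::ₘ gossipAfter i req) }
  | gossip (s i j t rest) (hj : .inl j ∉ s.crashed) (hnet : s.net = Msg.gossip i j t ::ₘ rest) :
      Step α e M s (.deliver (.gossip i j t))
        { s with
          storage := Function.update s.storage j (storageAfterGossip (s.storage j) t)
          net := rest }
  | reply (s i c q r rest) (hc : .inr c ∉ s.crashed) (hnet : s.net = Msg.reply i c q r ::ₘ rest) :
      Step α e M s (.deliver (.reply i c q r)) { s.receive i c q r with net := rest }

variable (C) in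
/-- An execution with malicious servers `M` from the initial message vector `m₀`. (A finite
execution is continued by idle actions.) -/
structure Execution [NeZero k] (α : Fin N → K) (e : ℕ) (m₀ : Fin k → K) (M : Finset (Fin N)) where
  state : ℕ → State N k K C
  act : ℕ → Action N k K C
  init : state 0 = initState α m₀
  step : ∀ n, Step α e M (state n) (act n) (state (n + 1))

end System

/-! ### The task: an atomic register whose operations terminate -/

/-- The action is the invocation of an operation by client `c`. -/
def Action.IsInv {N k : ℕ} {K C : Type*} (a : Action N k K C) (c : C) : Prop :=
  a = .invRead c ∨ ∃ m, a = .invWrite c m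

/-- The action is the return of an operation of client `c`. -/
def Action.IsRet {N k : ℕ} {K C : Type*} (a : Action N k K C) (c : C) : Prop :=
  a = .retWrite c ∨ ∃ v, a = .retRead c v

/-- The value of the register after action `a` took effect on the value `v`. -/
def Action.apply {N k : ℕ} [NeZero k] {K C : Type*} (v : K) : Action N k K C → K
  | .invWrite _ m => m 0
  | _ => v

section Task

variable {N k : ℕ} [NeZero k] {K C : Type*} [Field K] [LinearOrder C]
  {α : Fin N → K} {e : ℕ} {m₀ : Fin k → K} {M : Finset (Fin N)}

/-- The processes that crash at some time. -/
def Execution.faulty (E : Execution C α e m₀ M) : Set (Proc N C) :=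
  {p | ∃ n, p ∈ (E.state n).crashed}

/-- At most `f` servers crash (clients may crash without a bound). -/
def Execution.CrashesAtMost (E : Execution C α e m₀ M) (f : ℕ) : Prop :=
  {i : Fin N | Sum.inl i ∈ E.faulty}.ncard ≤ f

/-- Fairness: a message between processes that never crash is eventually delivered, and a client
that never crashes and has heard from a quorum eventually continues. -/
structure Execution.Fair (E : Execution C α e m₀ M) : Prop where
  deliver : ∀ n msg, msg ∈ (E.state n).net → msg.src ∉ E.faulty → msg.dst ∉ E.faulty →
    ∃ n' ≥ n, E.act n' = .deliver msg
  progress : ∀ n c, .inr c ∉ E.faulty → ((E.state n).client c).phase ≠ .idle →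
    ((E.state n).client c).HasQuorum e →
    ∃ n' ≥ n, E.act n' = .advance c ∨ (E.act n').IsRet c

/-- The operation invoked at time `n` returns at time `n'`. (Operations are identified by the
time of their invocation; each client invokes its operations one after the other.) -/
def Execution.Returns (E : Execution C α e m₀ M) (n n' : ℕ) : Prop :=
  ∃ c, (E.act n).IsInv c ∧ n < n' ∧ (E.act n').IsRet c ∧
    ∀ j, n < j → j < n' → ¬ (E.act j).IsRet c

/-- The actions before time `T` form a linearizable history of a read/write register with
initial value `m₀ 0`: there is a sequence `L` of operations, with all those that have returned
and possibly some pending ones, in which an operation that returned before another one was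
invoked does not come after it, and in which each returned read has returned the value of the
last write before it (the initial value if there is none). -/
def Execution.LinearizableUpTo (E : Execution C α e m₀ M) (T : ℕ) : Prop :=
  ∃ L : List ℕ, L.Nodup ∧
    (∀ n ∈ L, n < T ∧ ∃ c, (E.act n).IsInv c) ∧
    (∀ n n', n' < T → E.Returns n n' → n ∈ L) ∧
    L.Pairwise (fun a b => ¬ ∃ b', E.Returns b b' ∧ b' < a) ∧
    ∀ L₁ n L₂, L = L₁ ++ n :: L₂ → ∀ n' c v, n' < T → E.Returns n n' →
      E.act n' = .retRead c v →
      v = some (L₁.foldl (fun x j => (E.act j).apply x) (m₀ 0))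

/-- Every operation of a client that never crashes returns. -/
def Execution.Live (E : Execution C α e m₀ M) : Prop :=
  ∀ n c, (E.act n).IsInv c → .inr c ∉ E.faulty → ∃ n', E.Returns n n'

/-- Before time `n`, tag `t` was the tag of a write of the message vector `m` that had reached
its finalize phase; or `t` is the default tag and `m` the initial message vector. -/
def Execution.Finalized (E : Execution C α e m₀ M) (n : ℕ) (t : Tag C) (m : Fin k → K) : Prop :=
  (t = ⊥ ∧ m = m₀) ∨ ∃ n' < n, ∃ c, ((E.state n').client c).phase = .wFin m t

end Task

/-- The algorithm (with parameters `α`, `k`, `e` and initial message vector `m₀`) is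
`(s,t)`-robust: whenever at most `s` servers crash and at most `t` servers are malicious, it
implements an atomic register, and in fair executions every operation of a correct client
terminates. -/
def Robust {N k : ℕ} [NeZero k] {K : Type*} (C : Type*) [Field K] [LinearOrder C]
    (α : Fin N → K) (e : ℕ) (m₀ : Fin k → K) (s t : ℕ) : Prop :=
  ∀ (M : Finset (Fin N)) (E : Execution C α e m₀ M), M.card ≤ t → E.CrashesAtMost s →
    (∀ T, E.LinearizableUpTo T) ∧ (E.Fair → E.Live)

end CAS

/-! Decoding. Let at least `k + 2e` shares be received, at most `e` of them different from the
shares of `m`. A solution of the key equations exists: take the locator vanishing at the corrupted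
points. For every solution `(E, Q)` the polynomial `Q - msgPoly m * E` has degree below `k + e` and
vanishes at the at least `k + e` uncorrupted points, so it is zero and the decoder outputs `m`
(`berlekampWelch_eq`).

Quorums. Two quorums share at least `k + 2e` servers, and the servers that never crash form a quorum
because `k + 2(f + e) ≤ N`. The first fact carries safety, the second termination.

Tags. An operation returns only after a quorum has finalized its tag. A later query quorum meets
that quorum, and tags in replies are genuine, so a later operation selects a tag at least as large,
and a strictly larger one if it is a write (`le_tag`). Since a tag also names its client, different
writes have different tags (`write_tag_injective`).

Reads. A label `fin` above the default tag can be traced back to a write that has reached its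
finalize phase (`exists_finalized`). Hence no server can hold `⊥` under the tag of a write that is
still pre-writing, and at the end of its pre-write phase a quorum holds shares
(`exists_quorum_of_wFin`). The quorum answering a read of this tag meets that quorum in `k + 2e`
servers; all of them send a share, and only malicious servers send wrong ones, so decoding succeeds
(`read_shares`, `read_spec`).

Linearization. Operations are sorted by tag, a write before the reads of its tag, and otherwise by
invocation time. The order of tags makes this compatible with real time, and the last write before a
read is the one whose tag it selected. For termination, every access of a correct client is
eventually answered by all servers that never crash, and an operation has boundedly many phases. -/

namespace CAS

/-! ### Correctness of the Berlekamp–Welch decoder -/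

section Decoder

variable {N k : ℕ} {K : Type*} [Field K]

/-- The polynomial whose coefficients are the entries of `m`. -/
noncomputable def msgPoly (m : Fin k → K) : Polynomial K :=
  ∑ j : Fin k, Polynomial.monomial (j : ℕ) (m j)

theorem eval_msgPoly (α : Fin N → K) (m : Fin k → K) (i : Fin N) :
    (msgPoly m).eval (α i) = encode α m i := by
  simp [msgPoly, encode, Polynomial.eval_finsetSum]

theorem degree_msgPoly_lt (m : Fin k → K) : (msgPoly m).degree < (k : WithBot ℕ) := by
  rw [← Polynomial.mem_degreeLT]
  refine Submodule.sum_mem _ fun j _ => ?_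
  rw [Polynomial.mem_degreeLT]
  exact (Polynomial.degree_monomial_le _ _).trans_lt (by exact_mod_cast j.2)

theorem coeff_msgPoly (m : Fin k → K) (j : Fin k) : (msgPoly m).coeff (j : ℕ) = m j := by
  simp only [msgPoly, Polynomial.finsetSum_coeff, Polynomial.coeff_monomial]
  rw [Finset.sum_eq_single j] <;> simp +contextual [Fin.val_inj]

theorem degree_mul_msgPoly_lt {E : Polynomial K} {e : ℕ} (hE : E.natDegree ≤ e)
    (m : Fin k → K) : (msgPoly m * E).degree < ((k + e : ℕ) : WithBot ℕ) := by
  by_cases h0 : msgPoly m = 0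
  · simp [h0]
  by_cases hE0 : E = 0
  · simp [hE0]
  have h1 := degree_msgPoly_lt m
  rw [Polynomial.degree_eq_natDegree h0] at h1
  rw [Polynomial.degree_mul, Polynomial.degree_eq_natDegree h0, Polynomial.degree_eq_natDegree hE0]
  have h2 : (msgPoly m).natDegree < k := by exact_mod_cast h1
  have : (msgPoly m).natDegree + E.natDegree < k + e := by omega
  exact_mod_cast this

-- The locator is the product of `X - αᵢ` over the corrupted positions, paired with `msgPoly m`
-- times it: at a corrupted position both sides vanish, elsewhere the received value is that of
-- `msgPoly m`.
open Classical in
theorem exists_keySolution (α : Fin N → K) {e : ℕ} (m : Fin k → K) (y : Fin N → Option K)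
    (hc : numCorrupted α m y ≤ e) : ∃ EQ, IsKeySolution α k e y EQ := by
  let B := Finset.univ.filter fun i => y i ≠ none ∧ y i ≠ some (encode α m i)
  let E : Polynomial K := ∏ i ∈ B, (Polynomial.X - Polynomial.C (α i))
  have hE : E.natDegree ≤ e := by
    rw [Polynomial.natDegree_prod_of_monic _ _ fun i _ => Polynomial.monic_X_sub_C (α i)]
    simp only [Polynomial.natDegree_X_sub_C, Finset.sum_const, smul_eq_mul, mul_one]
    exact hc
  refine ⟨(E, msgPoly m * E), ?_, hE, degree_mul_msgPoly_lt hE m, fun i w hw => ?_⟩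
  · exact (Polynomial.monic_prod_of_monic B _ fun i _ => Polynomial.monic_X_sub_C (α i)).ne_zero
  · rw [Polynomial.eval_mul, eval_msgPoly]
    by_cases hi : i ∈ B
    · have : E.eval (α i) = 0 := by
        rw [Polynomial.eval_prod]
        exact Finset.prod_eq_zero hi (by simp)
      simp [this]
    · have : y i = some (encode α m i) := by
        by_contra h
        exact hi (by simp [B, hw]; simpa [hw] using h)
      rw [hw] at this
      rw [Option.some.inj this]

-- Uniqueness of the quotient although the solution itself is not unique: the difference of the two
-- sides has more zeros than its degree allows. This is why the arbitrary choice in the decoder does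
-- no harm.
open Classical in
theorem keySolution_eq {α : Fin N → K} (hα : Function.Injective α) {e : ℕ} {m : Fin k → K}
    {y : Fin N → Option K} (hr : k + 2 * e ≤ numReceived y) (hc : numCorrupted α m y ≤ e)
    {EQ : Polynomial K × Polynomial K} (h : IsKeySolution α k e y EQ) :
    EQ.2 = msgPoly m * EQ.1 := by
  obtain ⟨-, hE, hQ, hkey⟩ := h
  let R := Finset.univ.filter fun i => y i ≠ none
  let B := Finset.univ.filter fun i => y i ≠ none ∧ y i ≠ some (encode α m i)
  -- At least `k + 2e` received positions, less at most `e` corrupted ones.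
  have hcard : k + e ≤ (R \ B).card := by
    have h1 : R.card - B.card ≤ (R \ B).card := Finset.le_card_sdiff _ _
    have h2 : k + 2 * e ≤ R.card := hr
    have h3 : B.card ≤ e := hc
    omega
  rw [← sub_eq_zero]
  refine Polynomial.eq_zero_of_degree_lt_of_eval_index_eq_zero _ (hα.injOn (s := ↑(R \ B))) ?_ ?_
  · refine lt_of_lt_of_le ?_ (Nat.cast_le.2 hcard)
    exact (Polynomial.degree_sub_le _ _).trans_lt (max_lt hQ (degree_mul_msgPoly_lt hE m))
  · intro i hi
    have hi' : y i ≠ none ∧ y i = some (encode α m i) := by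
      simp only [R, B, Finset.mem_sdiff, Finset.mem_filter, Finset.mem_univ, true_and] at hi
      tauto
    rw [Polynomial.eval_sub, Polynomial.eval_mul, eval_msgPoly, hkey i _ hi'.2, sub_self]

theorem berlekampWelch_eq {α : Fin N → K} (hα : Function.Injective α) {e : ℕ} {m : Fin k → K}
    {y : Fin N → Option K} (hr : k + 2 * e ≤ numReceived y) (hc : numCorrupted α m y ≤ e) :
    berlekampWelch α k e y = some m := by
  have hex := exists_keySolution α m y hc
  have heq := keySolution_eq hα hr hc hex.choose_spec
  have hdvd : hex.choose.1 ∣ hex.choose.2 := by rw [heq]; exact dvd_mul_left _ _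
  rw [berlekampWelch, dif_pos hex, if_pos hdvd]
  congr 1
  funext j
  have : hex.choose.2 / hex.choose.1 = msgPoly m := by
    rw [heq]
    exact mul_div_cancel_right₀ _ hex.choose_spec.1
  rw [this, coeff_msgPoly]

end Decoder

/-! ### Quorums -/

/-- The ceiling enters only through this bound, which makes quorums overlap, and through
`quorumSize_le`, which makes a quorum of correct servers available. -/
theorem le_two_mul_quorumSize (N k e : ℕ) : N + k + 2 * e ≤ 2 * quorumSize N k e := by
  have h := Nat.le_ceil (((N + k + 2 * e : ℕ) : ℚ) / 2)
  rw [div_le_iff₀ (by norm_num)] at h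
  have : ((N + k + 2 * e : ℕ) : ℚ) ≤ ((quorumSize N k e * 2 : ℕ) : ℚ) := by
    rw [Nat.cast_mul]
    exact h
  have := Nat.cast_le.1 this
  omega

theorem quorumSize_le {N k e n : ℕ} (h : N + k + 2 * e ≤ 2 * n) : quorumSize N k e ≤ n := by
  refine Nat.ceil_le.2 ?_
  rw [div_le_iff₀ (by norm_num)]
  have : ((N + k + 2 * e : ℕ) : ℚ) ≤ ((2 * n : ℕ) : ℚ) := Nat.cast_le.2 h
  push_cast at this ⊢
  linarith

/-- Inclusion–exclusion: the sizes add up to at least `N + k + 2e`, while the union has at most `N`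
elements. -/
theorem le_card_inter_of_quorums {N k e : ℕ} {A B : Finset (Fin N)}
    (hA : quorumSize N k e ≤ A.card) (hB : quorumSize N k e ≤ B.card) :
    k + 2 * e ≤ (A ∩ B).card := by
  have h1 := le_two_mul_quorumSize N k e
  have h2 := Finset.card_union_add_card_inter A B
  have h3 : (A ∪ B).card ≤ N := (Finset.card_le_univ _).trans_eq (Fintype.card_fin N)
  omega

/-! ### Storages -/

section Storage

variable {N k : ℕ} {K C : Type*}

/-- The storage has a record with tag `t` labelled `fin`. -/
def HasFin (S : Finset (Rec K C)) (t : Tag C) : Prop := ∃ w, Rec.mk t w .fin ∈ S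

/-- The storage has a coded element with tag `t`. -/
def HasShare (S : Finset (Rec K C)) (t : Tag C) : Prop := ∃ w : K, ∃ d, Rec.mk t (some w) d ∈ S

theorem HasFin.mono {S S' : Finset (Rec K C)} {t : Tag C} (h : HasFin S t) (hS : S ⊆ S') :
    HasFin S' t :=
  h.imp fun _ h => hS h

theorem HasShare.mono {S S' : Finset (Rec K C)} {t : Tag C} (h : HasShare S t) (hS : S ⊆ S') :
    HasShare S' t :=
  h.imp fun _ => Exists.imp fun _ h => hS h

theorem storedShare_mem {S : Finset (Rec K C)} {t : Tag C} {w : K}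
    (h : storedShare S t = some w) : ∃ d, Rec.mk t (some w) d ∈ S := by
  classical
  rw [storedShare] at h
  split_ifs at h with h'
  rw [← Option.some.inj h]
  exact h'.choose_spec

theorem HasShare.storedShare_ne_none {S : Finset (Rec K C)} {t : Tag C} (h : HasShare S t) :
    storedShare S t ≠ none := by
  have h' : ∃ w : K, ∃ d, Rec.mk t (some w) d ∈ S := h
  rw [storedShare, dif_pos h']
  simp

theorem gossip_mem_gossipAfter {i i' j : Fin N} {q : Request K C} {t : Tag C}
    (h : (Msg.gossip i' j t : Msg N K C) ∈ gossipAfter i q) : q = .finW t ∨ q = .finR t := by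
  cases q <;> simp_all [gossipAfter]

theorem not_request_mem_gossipAfter {i j : Fin N} {c : C} {n : ℕ} {q r : Request K C} :
    (Msg.request c j n r : Msg N K C) ∉ gossipAfter i q := by
  cases q <;> simp [gossipAfter]

theorem not_reply_mem_gossipAfter {i j : Fin N} {c : C} {n : ℕ} {q : Request K C}
    {r : Rec K C} : (Msg.reply j c n r : Msg N K C) ∉ gossipAfter i q := by
  cases q <;> simp [gossipAfter]

theorem Client.shares_eq {cl : Client N k K C} {t : Tag C} {i : Fin N} {r : Rec K C}
    (h : cl.replies i = some r) (ht : r.tag = t) (hl : r.label = .fin) :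
    cl.shares t i = r.data := by
  simp [Client.shares, h, ht, hl]

variable [LinearOrder C]

theorem mem_relabel {S : Finset (Rec K C)} {t : Tag C} {r : Rec K C} :
    r ∈ relabel S t ↔ (r ∈ S ∧ r.tag ≠ t) ∨ (r.tag = t ∧ r.label = .fin ∧
      ∃ d, Rec.mk t r.data d ∈ S) := by
  classical
  rcases r with ⟨t', w, d⟩
  simp only [relabel, Finset.mem_image]
  constructor
  · rintro ⟨⟨t1, w1, d1⟩, h1, h2⟩
    split_ifs at h2 with h
    · simp only [Rec.mk.injEq] at h2 h
      obtain ⟨rfl, rfl, rfl⟩ := h2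
      subst h
      exact Or.inr ⟨rfl, rfl, _, h1⟩
    · obtain ⟨rfl, rfl, rfl⟩ := (Rec.mk.injEq ..).mp h2
      exact Or.inl ⟨h1, h⟩
  · rintro (⟨h1, h2⟩ | ⟨h1, h2, d', h3⟩)
    · exact ⟨_, h1, by rw [if_neg h2]⟩
    · obtain rfl : t' = t := h1
      obtain rfl : d = .fin := h2
      exact ⟨_, h3, by simp⟩

theorem HasFin.relabel {S : Finset (Rec K C)} {t : Tag C} (h : HasFin S t) (u : Tag C) :
    HasFin (relabel S u) t := by
  obtain ⟨w, hw⟩ := h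
  by_cases htu : t = u
  · subst htu
    exact ⟨w, mem_relabel.2 (Or.inr ⟨rfl, rfl, _, hw⟩)⟩
  · exact ⟨w, mem_relabel.2 (Or.inl ⟨hw, htu⟩)⟩

theorem HasShare.relabel {S : Finset (Rec K C)} {t : Tag C} (h : HasShare S t) (u : Tag C) :
    HasShare (relabel S u) t := by
  obtain ⟨w, d, hw⟩ := h
  by_cases htu : t = u
  · subst htu
    exact ⟨w, _, mem_relabel.2 (Or.inr ⟨rfl, rfl, _, hw⟩)⟩
  · exact ⟨w, d, mem_relabel.2 (Or.inl ⟨hw, htu⟩)⟩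

/-- No request deletes a record or withdraws a label `fin`. This and its three companions let facts
about a storage be carried forward in time. -/
theorem HasFin.storageAfter {S : Finset (Rec K C)} {t : Tag C} (h : HasFin S t)
    (q : Request K C) : HasFin (storageAfter S q) t := by
  classical
  cases q <;> simp only [CAS.storageAfter] <;> (try split_ifs) <;>
    first | exact h | exact h.relabel _ | exact h.mono (Finset.subset_insert _ _)

theorem HasShare.storageAfter {S : Finset (Rec K C)} {t : Tag C} (h : HasShare S t)
    (q : Request K C) : HasShare (storageAfter S q) t := by
  classical
  cases q <;> simp only [CAS.storageAfter] <;> (try split_ifs) <;>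
    first | exact h | exact h.relabel _ | exact h.mono (Finset.subset_insert _ _)

theorem HasFin.storageAfterGossip {S : Finset (Rec K C)} {t : Tag C} (h : HasFin S t)
    (u : Tag C) : HasFin (storageAfterGossip S u) t := by
  classical
  simp only [CAS.storageAfterGossip]
  split_ifs <;> first | exact h.relabel _ | exact h.mono (Finset.subset_insert _ _)

theorem HasShare.storageAfterGossip {S : Finset (Rec K C)} {t : Tag C} (h : HasShare S t)
    (u : Tag C) : HasShare (storageAfterGossip S u) t := by
  classical
  simp only [CAS.storageAfterGossip]
  split_ifs <;> first | exact h.relabel _ | exact h.mono (Finset.subset_insert _ _)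

theorem hasFin_relabel_self {S : Finset (Rec K C)} {t : Tag C} {w : Option K} {d : Label}
    (h : Rec.mk t w d ∈ S) : HasFin (relabel S t) t :=
  ⟨w, mem_relabel.2 (Or.inr ⟨rfl, rfl, _, h⟩)⟩

theorem hasFin_storageAfter_finW (S : Finset (Rec K C)) (t : Tag C) :
    HasFin (storageAfter S (.finW t)) t := by
  classical
  simp only [storageAfter]
  split_ifs with h
  · exact hasFin_relabel_self h.choose_spec
  · exact ⟨none, Finset.mem_insert_self _ _⟩

theorem hasFin_storageAfter_finR (S : Finset (Rec K C)) (t : Tag C) :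
    HasFin (storageAfter S (.finR t)) t := by
  classical
  simp only [storageAfter]
  split_ifs with h
  · obtain ⟨w, d, h⟩ := h
    exact hasFin_relabel_self h
  · exact ⟨none, Finset.mem_insert_self _ _⟩

/-- Records after a request. -/
theorem mem_storageAfter {S : Finset (Rec K C)} {q : Request K C} {r : Rec K C}
    (h : r ∈ storageAfter S q) :
    (∃ d, Rec.mk r.tag r.data d ∈ S ∧ (r.label = d ∨ r.label = .fin ∧
        (q = .finW r.tag ∨ q = .finR r.tag))) ∨
      (∃ w, q = .pre r.tag w ∧ r.data = some w ∧ r.label = .pre) ∨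
      (r.data = none ∧ r.label = .fin ∧ (q = .finW r.tag ∨ q = .finR r.tag)) := by
  classical
  have key : ∀ t, (q = .finW t ∨ q = .finR t) → r ∈ relabel S t →
      ∃ d, Rec.mk r.tag r.data d ∈ S ∧ (r.label = d ∨ r.label = .fin ∧
        (q = .finW r.tag ∨ q = .finR r.tag)) := by
    intro t ht hr
    rcases mem_relabel.1 hr with ⟨h1, -⟩ | ⟨rfl, h2, d, h3⟩
    · exact ⟨r.label, h1, Or.inl rfl⟩
    · exact ⟨d, h3, Or.inr ⟨h2, ht⟩⟩
  have old : r ∈ S → ∃ d, Rec.mk r.tag r.data d ∈ S ∧ (r.label = d ∨ r.label = .fin ∧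
        (q = .finW r.tag ∨ q = .finR r.tag)) := fun h => ⟨r.label, h, Or.inl rfl⟩
  cases q with
  | qry => exact Or.inl (old h)
  | pre t w =>
    simp only [storageAfter] at h
    split_ifs at h
    · exact Or.inl (old h)
    · rcases Finset.mem_insert.1 h with rfl | h
      · exact Or.inr (Or.inl ⟨w, rfl, rfl, rfl⟩)
      · exact Or.inl (old h)
  | finW t =>
    simp only [storageAfter] at h
    split_ifs at h
    · exact Or.inl (key t (Or.inl rfl) h)
    · rcases Finset.mem_insert.1 h with rfl | h
      · exact Or.inr (Or.inr ⟨rfl, rfl, Or.inl rfl⟩)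
      · exact Or.inl (old h)
  | finR t =>
    simp only [storageAfter] at h
    split_ifs at h
    · exact Or.inl (key t (Or.inr rfl) h)
    · rcases Finset.mem_insert.1 h with rfl | h
      · exact Or.inr (Or.inr ⟨rfl, rfl, Or.inr rfl⟩)
      · exact Or.inl (old h)

/-- Records after a gossip message. -/
theorem mem_storageAfterGossip {S : Finset (Rec K C)} {t : Tag C} {r : Rec K C}
    (h : r ∈ storageAfterGossip S t) :
    (∃ d, Rec.mk r.tag r.data d ∈ S ∧ (r.label = d ∨ r.label = .fin ∧ r.tag = t)) ∨
      (r.data = none ∧ r.label = .fin ∧ r.tag = t) := by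
  classical
  simp only [storageAfterGossip] at h
  split_ifs at h
  · rcases mem_relabel.1 h with ⟨h1, -⟩ | ⟨h1, h2, d, h3⟩
    · exact Or.inl ⟨r.label, h1, Or.inl rfl⟩
    · exact Or.inl ⟨d, by rwa [h1], Or.inr ⟨h2, h1⟩⟩
  · rcases Finset.mem_insert.1 h with rfl | h
    · exact Or.inr ⟨rfl, rfl, rfl⟩
    · exact Or.inl ⟨r.label, h, Or.inl rfl⟩

theorem HasFin.le_maxFin {S : Finset (Rec K C)} {t : Tag C} (h : HasFin S t) : t ≤ maxFin S := by
  classical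
  obtain ⟨w, hw⟩ := h
  exact Finset.le_sup (f := Rec.tag) (b := ⟨t, w, .fin⟩) (Finset.mem_filter.2 ⟨hw, rfl⟩)

theorem hasFin_maxFin (S : Finset (Rec K C)) : maxFin S = ⊥ ∨ HasFin S (maxFin S) := by
  classical
  rcases (S.filter fun r => r.label = Label.fin).eq_empty_or_nonempty with h | h
  · left
    rw [maxFin, h, Finset.sup_empty]
  · right
    obtain ⟨⟨t, w, d⟩, hr, h2⟩ := Finset.exists_mem_eq_sup _ h Rec.tag
    obtain ⟨hr, hd⟩ := Finset.mem_filter.1 hr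
    simp only at hd
    subst hd
    refine ⟨w, ?_⟩
    rw [maxFin, h2]
    exact hr

/-- `r` may be the reply of server `i` with storage `S` to a request. -/
def ValidReply (M : Finset (Fin N)) (S : Finset (Rec K C)) (i : Fin N) (q : Request K C)
    (r : Rec K C) : Prop :=
  r = correctReply S q ∨ i ∈ M ∧ Corruption (correctReply S q) r

theorem ValidReply.tag_eq {M : Finset (Fin N)} {S : Finset (Rec K C)} {i : Fin N}
    {q : Request K C} {r : Rec K C} (h : ValidReply M S i q r) :
    r.tag = (correctReply S q).tag := by
  rcases h with rfl | h
  exacts [rfl, h.2.1]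

theorem ValidReply.label_eq {M : Finset (Fin N)} {S : Finset (Rec K C)} {i : Fin N}
    {q : Request K C} {r : Rec K C} (h : ValidReply M S i q r) :
    r.label = (correctReply S q).label := by
  rcases h with rfl | h
  exacts [rfl, h.2.2.1]

theorem ValidReply.data_ne_none {M : Finset (Fin N)} {S : Finset (Rec K C)} {i : Fin N}
    {q : Request K C} {r : Rec K C} (h : ValidReply M S i q r)
    (h' : (correctReply S q).data ≠ none) : r.data ≠ none := by
  rcases h with rfl | h
  exacts [h', h.2.2.2 h']

theorem Tag.lt_next (t : Tag C) (c : C) : t < Tag.next t c := by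
  induction t using WithBot.recBotCoe with
  | bot => exact WithBot.bot_lt_coe _
  | coe x =>
    refine WithBot.coe_lt_coe.2 (Prod.Lex.lt_iff.2 (Or.inl ?_))
    rw [← PNat.coe_lt_coe]
    exact Nat.lt_succ_self _

theorem Client.exists_maxTag_eq (cl : Client N k K C) :
    cl.maxTag = ⊥ ∨ ∃ i r, cl.replies i = some r ∧ cl.maxTag = r.tag := by
  rcases (Finset.univ : Finset (Fin N)).eq_empty_or_nonempty with h | h
  · left
    rw [Client.maxTag, h, Finset.sup_empty]
  · obtain ⟨i, -, hi⟩ := Finset.exists_mem_eq_sup _ h fun i => (cl.replies i).elim ⊥ Rec.tag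
    cases hr : cl.replies i with
    | none =>
      left
      rw [Client.maxTag, hi, hr]
      rfl
    | some r =>
      right
      refine ⟨i, r, hr, ?_⟩
      rw [Client.maxTag, hi, hr]
      rfl

end Storage

/-! ### Single steps -/

section Steps

variable {N k : ℕ} {K C : Type*}

/-- The tag that has been selected in a phase. -/
def Phase.tag : Phase k K C → Option (Tag C)
  | .idle => none
  | .wQry _ => none
  | .wPre _ t => some t
  | .wFin _ t => some t
  | .rQry => none
  | .rFin t => some t

theorem State.mem_access_net [LinearOrder C] {s : State N k K C} {c : C} {ph : Phase k K C}
    {req : Fin N → Request K C} {msg : Msg N K C} :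
    msg ∈ (s.access c ph req).net ↔
      msg ∈ s.net ∨ ∃ i, Msg.request c i ((s.client c).seq + 1) (req i) = msg := by
  simp [State.access]

variable [Field K]

/-- The request sent to server `i` at the beginning of a phase. -/
def Phase.request (α : Fin N → K) : Phase k K C → Fin N → Option (Request K C)
  | .idle, _ => none
  | .wQry _, _ => some .qry
  | .wPre m t, i => some (.pre t (encode α m i))
  | .wFin _ t, _ => some (.finW t)
  | .rQry, _ => some .qry
  | .rFin t, _ => some (.finR t)

variable [LinearOrder C] [NeZero k]

/-- The possible changes of client `c` in a step. -/
inductive ClientStep (α : Fin N → K) (e : ℕ) (c : C) :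
    Client N k K C → Action N k K C → Client N k K C → Prop
  | stay (cl a) (h1 : ¬ a.IsInv c) (h2 : ¬ a.IsRet c) (h3 : a ≠ .advance c) :
      ClientStep α e c cl a cl
  | receive (cl i r) :
      ClientStep α e c cl (.deliver (.reply i c cl.seq r))
        { cl with replies := Function.update cl.replies i (some r) }
  | invWrite (cl m) (hp : cl.phase = .idle) :
      ClientStep α e c cl (.invWrite c m) ⟨.wQry m, cl.seq + 1, fun _ => none⟩
  | invRead (cl) (hp : cl.phase = .idle) :
      ClientStep α e c cl (.invRead c) ⟨.rQry, cl.seq + 1, fun _ => none⟩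
  | preWrite (cl m) (hp : cl.phase = .wQry m) (hq : cl.HasQuorum e) :
      ClientStep α e c cl (.advance c) ⟨.wPre m (cl.maxTag.next c), cl.seq + 1, fun _ => none⟩
  | finalizeWrite (cl m t) (hp : cl.phase = .wPre m t) (hq : cl.HasQuorum e) :
      ClientStep α e c cl (.advance c) ⟨.wFin m t, cl.seq + 1, fun _ => none⟩
  | retWrite (cl m t) (hp : cl.phase = .wFin m t) (hq : cl.HasQuorum e) :
      ClientStep α e c cl (.retWrite c) ⟨.idle, cl.seq, fun _ => none⟩
  | finalizeRead (cl) (hp : cl.phase = .rQry) (hq : cl.HasQuorum e) :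
      ClientStep α e c cl (.advance c) ⟨.rFin cl.maxTag, cl.seq + 1, fun _ => none⟩
  | retRead (cl t) (hp : cl.phase = .rFin t) (hq : cl.HasQuorum e) :
      ClientStep α e c cl (.retRead c (cl.readResult α e t)) ⟨.idle, cl.seq, fun _ => none⟩

variable {α : Fin N → K} {e : ℕ} {M : Finset (Fin N)} {s s' : State N k K C}
  {a : Action N k K C}

/-- Projecting a step to one client removes the network and the other clients, so that the facts
about phases below become finite case checks. -/
theorem Step.client (h : Step α e M s a s') (c : C) :
    ClientStep α e c (s.client c) a (s'.client c) := by
  cases h with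
  | idle => exact .stay _ _ (by simp [Action.IsInv]) (by simp [Action.IsRet]) (by simp)
  | crash p => exact .stay _ _ (by simp [Action.IsInv]) (by simp [Action.IsRet]) (by simp)
  | invWrite c' m hc hp =>
    by_cases h : c = c'
    · subst h; simpa [State.access] using ClientStep.invWrite (α := α) (e := e) (c := c) _ m hp
    · simpa [State.access, h] using ClientStep.stay (α := α) (e := e) (c := c) (s.client c) _
        (by simp [Action.IsInv, Ne.symm h]) (by simp [Action.IsRet]) (by simp)
  | invRead c' hc hp =>
    by_cases h : c = c'
    · subst h; simpa [State.access] using ClientStep.invRead (α := α) (e := e) (c := c) _ hp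
    · simpa [State.access, h] using ClientStep.stay (α := α) (e := e) (c := c) (s.client c) _
        (by simp [Action.IsInv, Ne.symm h]) (by simp [Action.IsRet]) (by simp)
  | preWrite c' m hc hp hq =>
    by_cases h : c = c'
    · subst h; simpa [State.access] using ClientStep.preWrite (α := α) (e := e) (c := c) _ m hp hq
    · simpa [State.access, h] using ClientStep.stay (α := α) (e := e) (c := c) (s.client c) _
        (by simp [Action.IsInv]) (by simp [Action.IsRet]) (by simp [Ne.symm h])
  | finalizeWrite c' m t hc hp hq =>
    by_cases h : c = c'
    · subst h
      simpa [State.access] using ClientStep.finalizeWrite (α := α) (e := e) (c := c) _ m t hp hq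
    · simpa [State.access, h] using ClientStep.stay (α := α) (e := e) (c := c) (s.client c) _
        (by simp [Action.IsInv]) (by simp [Action.IsRet]) (by simp [Ne.symm h])
  | retWrite c' m t hc hp hq =>
    by_cases h : c = c'
    · subst h
      simpa [State.finish] using ClientStep.retWrite (α := α) (e := e) (c := c) _ m t hp hq
    · simpa [State.finish, h] using ClientStep.stay (α := α) (e := e) (c := c) (s.client c) _
        (by simp [Action.IsInv]) (by simp [Action.IsRet, Ne.symm h]) (by simp)
  | finalizeRead c' hc hp hq =>
    by_cases h : c = c'
    · subst h
      simpa [State.access] using ClientStep.finalizeRead (α := α) (e := e) (c := c) _ hp hq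
    · simpa [State.access, h] using ClientStep.stay (α := α) (e := e) (c := c) (s.client c) _
        (by simp [Action.IsInv]) (by simp [Action.IsRet]) (by simp [Ne.symm h])
  | retRead c' t hc hp hq =>
    by_cases h : c = c'
    · subst h
      simpa [State.finish] using ClientStep.retRead (α := α) (e := e) (c := c) _ t hp hq
    · simpa [State.finish, h] using ClientStep.stay (α := α) (e := e) (c := c) (s.client c) _
        (by simp [Action.IsInv]) (by simp [Action.IsRet, Ne.symm h]) (by simp)
  | request c' i q req rest r hi hnet hr =>
    exact .stay _ _ (by simp [Action.IsInv]) (by simp [Action.IsRet]) (by simp)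
  | gossip i j t rest hj hnet =>
    exact .stay _ _ (by simp [Action.IsInv]) (by simp [Action.IsRet]) (by simp)
  | reply i c' q r rest hc hnet =>
    by_cases h : c = c' ∧ q = (s.client c).seq
    · obtain ⟨rfl, rfl⟩ := h
      simpa [State.receive] using ClientStep.receive (α := α) (e := e) (c := c) (s.client c) i r
    · have : (s.receive i c' q r).client c = s.client c := by
        by_cases h' : c = c'
        · subst h'
          have : ¬ q = (s.client c).seq := fun h' => h ⟨rfl, h'⟩
          simp [State.receive, this]
        · simp [State.receive, h']
      simp only [this]
      exact .stay _ _ (by simp [Action.IsInv]) (by simp [Action.IsRet]) (by simp)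

/-- Every request that is new after a step was sent at the beginning of a phase. -/
theorem Step.request_mem (h : Step α e M s a s') {c : C} {i : Fin N} {q : ℕ}
    {req : Request K C} (hm : Msg.request c i q req ∈ s'.net) :
    Msg.request c i q req ∈ s.net ∨ (s.client c).seq + 1 = q ∧ (s'.client c).seq = q ∧
      (s'.client c).phase.request α i = some req := by
  have key : ∀ c' ph req', Msg.request c i q req ∈ (s.access c' ph req').net →
      (∀ j, ph.request α j = some (req' j)) →
      Msg.request c i q req ∈ s.net ∨ (s.client c).seq + 1 = q ∧
        ((s.access c' ph req').client c).seq = q ∧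
        ((s.access c' ph req').client c).phase.request α i = some req := by
    intro c' ph req' hm hreq
    rcases State.mem_access_net.1 hm with hm | ⟨j, hj⟩
    · exact Or.inl hm
    · cases hj
      exact Or.inr ⟨rfl, by simp [State.access], by simp [State.access, hreq]⟩
  cases h with
  | idle => exact Or.inl hm
  | crash p => exact Or.inl hm
  | invWrite c' m hc hp => exact key _ _ _ hm fun _ => rfl
  | invRead c' hc hp => exact key _ _ _ hm fun _ => rfl
  | preWrite c' m hc hp hq => exact key _ _ _ hm fun _ => rfl
  | finalizeWrite c' m t hc hp hq => exact key _ _ _ hm fun _ => rfl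
  | retWrite c' m t hc hp hq => exact Or.inl hm
  | finalizeRead c' hc hp hq => exact key _ _ _ hm fun _ => rfl
  | retRead c' t hc hp hq => exact Or.inl hm
  | request c' i' q' req' rest r hi hnet hr =>
    simp only [Multiset.mem_add, Multiset.mem_cons, reduceCtorEq,
      not_request_mem_gossipAfter, or_false] at hm
    exact Or.inl (hnet ▸ Multiset.mem_cons_of_mem hm)
  | gossip i' j t rest hj hnet => exact Or.inl (hnet ▸ Multiset.mem_cons_of_mem hm)
  | reply i' c' q' r rest hc hnet => exact Or.inl (hnet ▸ Multiset.mem_cons_of_mem hm)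

/-- Every reply that is new after a step was sent by a server on a request. -/
theorem Step.reply_mem (h : Step α e M s a s') {c : C} {i : Fin N} {q : ℕ}
    {r : Rec K C} (hm : Msg.reply i c q r ∈ s'.net) :
    Msg.reply i c q r ∈ s.net ∨ ∃ req, Msg.request c i q req ∈ s.net ∧
      s'.storage i = storageAfter (s.storage i) req ∧ ValidReply M (s.storage i) i req r := by
  have key : ∀ c' ph req', Msg.reply i c q r ∈ (s.access c' ph req').net →
      Msg.reply i c q r ∈ s.net := by
    intro c' ph req' hm
    rcases State.mem_access_net.1 hm with hm | ⟨j, hj⟩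
    · exact hm
    · cases hj
  cases h with
  | idle => exact Or.inl hm
  | crash p => exact Or.inl hm
  | invWrite c' m hc hp => exact Or.inl (key _ _ _ hm)
  | invRead c' hc hp => exact Or.inl (key _ _ _ hm)
  | preWrite c' m hc hp hq => exact Or.inl (key _ _ _ hm)
  | finalizeWrite c' m t hc hp hq => exact Or.inl (key _ _ _ hm)
  | retWrite c' m t hc hp hq => exact Or.inl hm
  | finalizeRead c' hc hp hq => exact Or.inl (key _ _ _ hm)
  | retRead c' t hc hp hq => exact Or.inl hm
  | request c' i' q' req' rest r' hi hnet hr =>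
    simp only [Multiset.mem_add, Multiset.mem_cons,
      not_reply_mem_gossipAfter, or_false] at hm
    rcases hm with hm | hm
    · exact Or.inl (hnet ▸ Multiset.mem_cons_of_mem hm)
    · cases hm
      exact Or.inr ⟨req', hnet ▸ Multiset.mem_cons_self _ _, by simp, hr⟩
  | gossip i' j t rest hj hnet => exact Or.inl (hnet ▸ Multiset.mem_cons_of_mem hm)
  | reply i' c' q' r rest hc hnet => exact Or.inl (hnet ▸ Multiset.mem_cons_of_mem hm)

/-- Every gossip message that is new after a step was sent on a finalize request. -/
theorem Step.gossip_mem (h : Step α e M s a s') {i j : Fin N} {t : Tag C}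
    (hm : Msg.gossip i j t ∈ s'.net) :
    Msg.gossip i j t ∈ s.net ∨ ∃ c i q req, Msg.request c i q req ∈ s.net ∧
      (req = .finW t ∨ req = .finR t) := by
  have key : ∀ c' ph req', Msg.gossip i j t ∈ (s.access c' ph req').net →
      Msg.gossip i j t ∈ s.net := by
    intro c' ph req' hm
    rcases State.mem_access_net.1 hm with hm | ⟨j, hj⟩
    · exact hm
    · cases hj
  cases h with
  | idle => exact Or.inl hm
  | crash p => exact Or.inl hm
  | invWrite c' m hc hp => exact Or.inl (key _ _ _ hm)
  | invRead c' hc hp => exact Or.inl (key _ _ _ hm)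
  | preWrite c' m hc hp hq => exact Or.inl (key _ _ _ hm)
  | finalizeWrite c' m t hc hp hq => exact Or.inl (key _ _ _ hm)
  | retWrite c' m t hc hp hq => exact Or.inl hm
  | finalizeRead c' hc hp hq => exact Or.inl (key _ _ _ hm)
  | retRead c' t hc hp hq => exact Or.inl hm
  | request c' i' q' req' rest r' hi hnet hr =>
    simp only [Multiset.mem_add, Multiset.mem_cons, reduceCtorEq, false_or] at hm
    rcases hm with hm | hm
    · exact Or.inl (hnet ▸ Multiset.mem_cons_of_mem hm)
    · exact Or.inr ⟨c', i', q', req', hnet ▸ Multiset.mem_cons_self _ _,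
        gossip_mem_gossipAfter hm⟩
  | gossip i' j t rest hj hnet => exact Or.inl (hnet ▸ Multiset.mem_cons_of_mem hm)
  | reply i' c' q' r rest hc hnet => exact Or.inl (hnet ▸ Multiset.mem_cons_of_mem hm)

/-- The possible changes of a storage in a step. -/
theorem Step.storage_eq (h : Step α e M s a s') (i : Fin N) :
    s'.storage i = s.storage i ∨
      (∃ c q req, Msg.request c i q req ∈ s.net ∧
        s'.storage i = storageAfter (s.storage i) req) ∨
      ∃ j t, Msg.gossip j i t ∈ s.net ∧ s'.storage i = storageAfterGossip (s.storage i) t := by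
  cases h with
  | request c' i' q' req' rest r' hi hnet hr =>
    by_cases h : i = i'
    · subst h
      exact Or.inr (Or.inl ⟨c', q', req', hnet ▸ Multiset.mem_cons_self _ _, by simp⟩)
    · exact Or.inl (by simp [h])
  | gossip i' j t rest hj hnet =>
    by_cases h : i = j
    · subst h
      exact Or.inr (Or.inr ⟨i', t, hnet ▸ Multiset.mem_cons_self _ _, by simp⟩)
    · exact Or.inl (by simp [h])
  | _ => exact Or.inl rfl

/-- A reply that is delivered was in transit. -/
theorem Step.mem_net_of_deliver {msg : Msg N K C} (h : Step α e M s (.deliver msg) s') :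
    msg ∈ s.net := by
  cases h with
  | request c' i' q' req' rest r' hi hnet hr => exact hnet ▸ Multiset.mem_cons_self _ _
  | gossip i' j t rest hj hnet => exact hnet ▸ Multiset.mem_cons_self _ _
  | reply i' c' q' r rest hc hnet => exact hnet ▸ Multiset.mem_cons_self _ _

/-- A server replies to every request that is delivered. -/
theorem Step.exists_reply_of_deliver_request {c : C} {i : Fin N} {q : ℕ} {req : Request K C}
    (h : Step α e M s (.deliver (.request c i q req)) s') : ∃ r, Msg.reply i c q r ∈ s'.net := by
  cases h with
  | request c' i' q' req' rest r' hi hnet hr => exact ⟨r', by simp⟩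

/-- A client takes note of a reply to its current access. -/
theorem Step.replies_of_deliver_reply {c : C} {i : Fin N} {r : Rec K C}
    (h : Step α e M s (.deliver (.reply i c (s.client c).seq r)) s') :
    (s'.client c).replies i ≠ none := by
  generalize hq : (s.client c).seq = q at h
  cases h with
  | reply i' c' q' r' rest hc hnet => simp [State.receive, hq]

/-- At the beginning of a phase, requests to all servers are in transit. -/
theorem Step.request_mem_of_phase (h : Step α e M s a s') {c : C}
    (ha : a.IsInv c ∨ a = .advance c) :
    (s'.client c).phase ≠ .idle ∧
      ∀ i, ∃ req, Msg.request c i (s'.client c).seq req ∈ s'.net := by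
  have key : ∀ ph (req' : Fin N → Request K C), ph ≠ .idle →
      ((s.access c ph req').client c).phase ≠ .idle ∧
      ∀ i, ∃ req, Msg.request c i ((s.access c ph req').client c).seq req ∈
        (s.access c ph req').net := by
    intro ph req' hph
    refine ⟨by simpa [State.access] using hph, fun i => ⟨req' i, State.mem_access_net.2
      (Or.inr ⟨i, by simp [State.access]⟩)⟩⟩
  cases h with
  | invWrite c' m hc hp =>
    obtain rfl : c' = c := by simpa [Action.IsInv] using ha
    exact key _ _ (by simp)
  | invRead c' hc hp =>
    obtain rfl : c' = c := by simpa [Action.IsInv] using ha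
    exact key _ _ (by simp)
  | preWrite c' m hc hp hq =>
    obtain rfl : c' = c := by simpa [Action.IsInv] using ha
    exact key _ _ (by simp)
  | finalizeWrite c' m hc hp hq =>
    obtain rfl : c' = c := by simpa [Action.IsInv] using ha
    exact key _ _ (by simp)
  | finalizeRead c' hc hp hq =>
    obtain rfl : c' = c := by simpa [Action.IsInv] using ha
    exact key _ _ (by simp)
  | _ => simp [Action.IsInv] at ha

end Steps

/-! ### Histories -/

section Phases

variable {N k : ℕ} {K C : Type*}

/-- The message vector written by the current operation. -/
def Phase.message : Phase k K C → Option (Fin k → K)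
  | .idle => none
  | .wQry m => some m
  | .wPre m _ => some m
  | .wFin m _ => some m
  | .rQry => none
  | .rFin _ => none

/-- The action by which client `c` has invoked its current operation. -/
def Phase.invocation (N : ℕ) (c : C) : Phase k K C → Option (Action N k K C)
  | .idle => none
  | .wQry m => some (.invWrite c m)
  | .wPre m _ => some (.invWrite c m)
  | .wFin m _ => some (.invWrite c m)
  | .rQry => some (.invRead c)
  | .rFin _ => some (.invRead c)

/-- An upper bound on the number of phases that remain, the present one included. -/
def Phase.remaining : Phase k K C → ℕ
  | .idle => 0
  | .wQry _ => 3
  | .wPre _ _ => 2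
  | .wFin _ _ => 1
  | .rQry => 2
  | .rFin _ => 1

theorem Phase.isInv_of_invocation {ph : Phase k K C} {c : C} {a : Action N k K C}
    (h : ph.invocation N c = some a) : a.IsInv c := by
  cases ph <;> simp only [invocation, Option.some.injEq, reduceCtorEq] at h <;> subst h <;>
    simp [Action.IsInv]

theorem Phase.invocation_of_message {ph : Phase k K C} {m : Fin k → K} (c : C)
    (h : ph.message = some m) : ph.invocation N c = some (.invWrite c m) := by
  cases ph <;> simp_all [invocation, message]

theorem Phase.message_of_invocation {ph : Phase k K C} {m : Fin k → K} {c c' : C}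
    (h : ph.invocation N c = some (.invWrite c' m)) : ph.message = some m := by
  cases ph <;> simp_all [invocation, message]

theorem Phase.ne_idle_of_tag {ph : Phase k K C} {t : Tag C} (h : ph.tag = some t) :
    ph ≠ .idle := by
  rintro rfl
  cases h

variable [Field K] [LinearOrder C] [NeZero k] {α : Fin N → K} {e : ℕ} {c : C}
  {cl cl' : Client N k K C} {a : Action N k K C}

theorem ClientStep.invocation (h : ClientStep α e c cl a cl') (hp : cl'.phase ≠ .idle) :
    (¬ a.IsInv c ∧ ¬ a.IsRet c ∧ cl.phase ≠ .idle ∧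
      cl'.phase.invocation N c = cl.phase.invocation N c) ∨
      a.IsInv c ∧ cl'.phase.invocation N c = some a := by
  cases h <;> simp_all [Phase.invocation, Action.IsInv, Action.IsRet]

theorem ClientStep.phase_of_isInv (h : ClientStep α e c cl a cl') (ha : a.IsInv c) :
    cl.phase = .idle ∧ cl'.phase ≠ .idle ∧ cl'.phase.tag = none ∧ cl'.seq = cl.seq + 1 := by
  cases h <;> simp_all [Action.IsInv, Phase.tag]

theorem ClientStep.remaining_le (h : ClientStep α e c cl a cl') (ha : ¬ a.IsInv c) :
    cl'.phase.remaining ≤ cl.phase.remaining ∧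
      ∀ t, cl.phase.tag = some t → cl'.phase.tag = some t ∨ cl'.phase = .idle := by
  cases h <;> simp_all [Action.IsInv, Phase.tag, Phase.remaining]

theorem ClientStep.remaining_lt_of_advance (h : ClientStep α e c cl a cl') (ha : a = .advance c) :
    cl'.phase.remaining < cl.phase.remaining := by
  cases h <;> simp_all [Phase.remaining]

theorem ClientStep.of_tag (h : ClientStep α e c cl a cl') {t : Tag C}
    (ht : cl'.phase.tag = some t) : ¬ a.IsInv c ∧ cl'.phase.message = cl.phase.message ∧
      (cl.phase.tag = some t ∨ cl.HasQuorum e ∧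
        (∃ m, cl.phase = .wQry m ∧ cl'.phase = .wPre m t ∧ t = cl.maxTag.next c) ∨
        cl.HasQuorum e ∧ cl.phase = .rQry ∧ cl'.phase = .rFin t ∧ t = cl.maxTag) := by
  cases h <;> simp_all [Action.IsInv, Phase.tag, Phase.message]

/-- A write that has its tag can end only by its return, which presupposes a quorum of replies in
the finalize phase. -/
theorem ClientStep.of_write_tag (h : ClientStep α e c cl a cl') {t : Tag C} {m : Fin k → K}
    (ht : cl.phase.tag = some t) (hm : cl.phase.message = some m) : ¬ a.IsInv c ∧
      (cl'.phase.tag = some t ∧ cl'.phase.message = some m ∨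
        cl.HasQuorum e ∧ cl.phase = .wFin m t) := by
  rcases cl with ⟨ph, q, rs⟩
  cases h <;> cases ph <;> simp_all [Action.IsInv, Phase.tag, Phase.message]

theorem ClientStep.of_isRet (h : ClientStep α e c cl a cl') (ha : a.IsRet c) :
    cl.HasQuorum e ∧ cl'.phase = .idle ∧ ((∃ m t, cl.phase = .wFin m t ∧ a = .retWrite c) ∨
      ∃ t, cl.phase = .rFin t ∧ a = .retRead c (cl.readResult α e t)) := by
  cases h <;> simp_all [Action.IsRet]

theorem ClientStep.of_wFin (h : ClientStep α e c cl a cl') {t : Tag C} {m : Fin k → K}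
    (ht : cl'.phase = .wFin m t) : cl.phase = .wFin m t ∨ cl.HasQuorum e ∧ cl.phase = .wPre m t := by
  cases h <;> simp_all

/-- Each new access erases the replies, so those present always belong to the current number. A
return keeps the number; this is why the phase may become idle within one access. -/
theorem ClientStep.seq_replies (h : ClientStep α e c cl a cl') :
    (cl'.seq = cl.seq ∧ ¬ a.IsInv c ∧ (cl'.phase = cl.phase ∨ cl'.phase = .idle) ∧
      ∀ i r, cl'.replies i = some r → cl.replies i = some r ∨
        a = .deliver (.reply i c cl.seq r)) ∨
      cl'.seq = cl.seq + 1 ∧ ∀ i, cl'.replies i = none := by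
  cases h with
  | receive i r =>
    left
    refine ⟨rfl, by simp [Action.IsInv], Or.inl rfl, fun j r' h => ?_⟩
    by_cases hj : j = i
    · subst hj
      right
      simpa [eq_comm] using h
    · left
      simpa [hj] using h
  | _ => simp_all [Action.IsInv]

theorem ClientStep.replies_of_continue (h : ClientStep α e c cl a cl') (h1 : ¬ a.IsRet c)
    (h2 : a ≠ .advance c) (h3 : cl.phase ≠ .idle) :
    cl'.seq = cl.seq ∧ cl'.phase = cl.phase ∧ ∀ i, cl.replies i ≠ none → cl'.replies i ≠ none := by
  cases h with
  | receive i r =>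
    refine ⟨rfl, rfl, fun j hj => ?_⟩
    by_cases h : j = i
    · subst h; simp
    · simpa [h] using hj
  | _ => simp_all [Action.IsRet]

theorem ClientStep.ne_idle (h : ClientStep α e c cl a cl') (h1 : ¬ a.IsRet c)
    (h2 : cl.phase ≠ .idle) : cl'.phase ≠ .idle := by
  cases h <;> simp_all [Action.IsRet]

end Phases

/-! ### Operations and quorum accesses along an execution -/

namespace Execution

variable {N k : ℕ} [NeZero k] {K C : Type*} [Field K] [LinearOrder C]
  {α : Fin N → K} {e : ℕ} {m₀ : Fin k → K} {M : Finset (Fin N)}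

/-- The state of client `c` at time `j`. -/
abbrev cl (E : Execution C α e m₀ M) (c : C) (j : ℕ) : Client N k K C := (E.state j).client c

variable (E : Execution C α e m₀ M)

theorem clientStep (c : C) (j : ℕ) :
    ClientStep α e c (E.cl c j) (E.act j) (E.cl c (j + 1)) :=
  (E.step j).client c

theorem cl_zero (c : C) : E.cl c 0 = ⟨.idle, 0, fun _ => none⟩ := by
  rw [cl, E.init]
  rfl

open Classical in
/-- The time of the last invocation of an operation by client `c` before time `j`. -/
noncomputable def lastInv (c : C) : ℕ → ℕ
  | 0 => 0
  | j + 1 => if (E.act j).IsInv c then j else lastInv c j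

variable {E} {c : C}

theorem lastInv_succ_of_isInv {j : ℕ} (h : (E.act j).IsInv c) : E.lastInv c (j + 1) = j :=
  if_pos h

theorem lastInv_succ_of_not_isInv {j : ℕ} (h : ¬ (E.act j).IsInv c) :
    E.lastInv c (j + 1) = E.lastInv c j :=
  if_neg h

theorem lastInv_le (j : ℕ) : E.lastInv c (j + 1) ≤ j := by
  induction j with
  | zero => simp [lastInv]
  | succ j ih =>
    rw [lastInv]
    split_ifs <;> omega

/-- The value `0` of `lastInv` is also its default before any invocation; a client that is not idle
has invoked an operation, so there the value is genuine and identifies the operation. -/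
theorem lastInv_spec {j : ℕ} (h : (E.cl c j).phase ≠ .idle) : E.lastInv c j < j ∧
    (E.cl c j).phase.invocation N c = some (E.act (E.lastInv c j)) ∧
    ∀ l, E.lastInv c j < l → l < j → ¬ (E.act l).IsRet c := by
  induction j with
  | zero => simp [cl_zero] at h
  | succ j ih =>
    rcases (E.clientStep c j).invocation h with ⟨h1, h2, h3, h4⟩ | ⟨h1, h2⟩
    · obtain ⟨i1, i2, i3⟩ := ih h3
      rw [lastInv_succ_of_not_isInv h1]
      refine ⟨by omega, h4.trans i2, fun l hl hlj => ?_⟩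
      rcases Nat.lt_succ_iff_lt_or_eq.1 hlj with hl' | rfl
      exacts [i3 l hl hl', h2]
    · rw [lastInv_succ_of_isInv h1]
      exact ⟨by omega, h2, fun l hl hlj => by omega⟩

theorem isInv_lastInv {j : ℕ} (h : (E.cl c j).phase ≠ .idle) :
    (E.act (E.lastInv c j)).IsInv c :=
  Phase.isInv_of_invocation (lastInv_spec h).2.1

/-- Within an operation the phases follow each other, and the tag is kept. -/
theorem phase_of_lastInv_eq {i j : ℕ} (hij : i ≤ j) (hi : (E.cl c i).phase ≠ .idle)
    (h : E.lastInv c j = E.lastInv c i) :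
    (E.cl c j).phase.remaining ≤ (E.cl c i).phase.remaining ∧
      ∀ t, (E.cl c i).phase.tag = some t →
        (E.cl c j).phase.tag = some t ∨ (E.cl c j).phase = .idle := by
  induction j, hij using Nat.le_induction with
  | base => exact ⟨le_rfl, fun t ht => Or.inl ht⟩
  | succ j hij ih =>
    have hlt := (lastInv_spec hi).1
    -- A new invocation at `j` would make `j` the last invocation, but that of time `i` precedes `i
    -- ≤ j`.
    have hinv : ¬ (E.act j).IsInv c := by
      intro hinv
      rw [lastInv_succ_of_isInv hinv] at h
      omega
    obtain ⟨h1, h2⟩ := ih (by rw [← h, lastInv_succ_of_not_isInv hinv])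
    obtain ⟨h3, h4⟩ := (E.clientStep c j).remaining_le hinv
    refine ⟨h3.trans h1, fun t ht => ?_⟩
    rcases h2 t ht with h5 | h5
    · exact h4 t h5
    · right
      rw [h5] at h3
      revert h3
      cases (E.cl c (j + 1)).phase <;> simp [Phase.remaining]

theorem seq_mono {i j : ℕ} (hij : i ≤ j) : (E.cl c i).seq ≤ (E.cl c j).seq := by
  induction j, hij using Nat.le_induction with
  | base => exact le_rfl
  | succ j hij ih => rcases (E.clientStep c j).seq_replies with h | h <;> omega

/-- During an access, the client stays in its phase or ends its operation. -/
theorem phase_of_seq_eq {i j : ℕ} (hij : i ≤ j) (h : (E.cl c j).seq = (E.cl c i).seq) :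
    ((E.cl c j).phase = (E.cl c i).phase ∨ (E.cl c j).phase = .idle) ∧
      E.lastInv c j = E.lastInv c i := by
  induction j, hij using Nat.le_induction with
  | base => exact ⟨Or.inl rfl, rfl⟩
  | succ j hij ih =>
    have h1 : (E.cl c i).seq ≤ (E.cl c j).seq := seq_mono hij
    rcases (E.clientStep c j).seq_replies with ⟨h2, h3, h4, -⟩ | h2
    · obtain ⟨h5, h6⟩ := ih (by omega)
      refine ⟨?_, (lastInv_succ_of_not_isInv h3).trans h6⟩
      rcases h4 with h4 | h4
      · rwa [h4]
      · exact Or.inr h4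
    · omega

variable (E) in
/-- At time `a`, client `c` starts access number `q` and sends request `req` to server `i`. -/
def Sends (c : C) (i : Fin N) (q : ℕ) (req : Request K C) (a : ℕ) : Prop :=
  (E.cl c a).seq + 1 = q ∧ (E.cl c (a + 1)).seq = q ∧
    (E.cl c (a + 1)).phase.request α i = some req

theorem exists_sends_of_request_mem {i : Fin N} {q : ℕ} {req : Request K C} {j : ℕ}
    (h : Msg.request c i q req ∈ (E.state j).net) : ∃ a < j, E.Sends c i q req a := by
  induction j with
  | zero => simp [E.init, initState] at h
  | succ j ih =>
    rcases (E.step j).request_mem h with h | h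
    · obtain ⟨a, ha, h⟩ := ih h
      exact ⟨a, by omega, h⟩
    · exact ⟨j, by omega, h⟩

variable (E) in
/-- Server `i` handles request `req` at time `b` and replies `r`. -/
def Handles (i : Fin N) (req : Request K C) (r : Rec K C) (b : ℕ) : Prop :=
  (E.state (b + 1)).storage i = storageAfter ((E.state b).storage i) req ∧
    ValidReply M ((E.state b).storage i) i req r

theorem exists_handles_of_reply_mem {i : Fin N} {q : ℕ} {r : Rec K C} {j : ℕ}
    (h : Msg.reply i c q r ∈ (E.state j).net) :
    ∃ a b req, a < b ∧ b < j ∧ E.Sends c i q req a ∧ E.Handles i req r b := by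
  induction j with
  | zero => simp [E.init, initState] at h
  | succ j ih =>
    rcases (E.step j).reply_mem h with h | ⟨req, h1, h2, h3⟩
    · obtain ⟨a, b, req, hab, hb, h⟩ := ih h
      exact ⟨a, b, req, hab, by omega, h⟩
    · obtain ⟨a, ha, h⟩ := exists_sends_of_request_mem h1
      exact ⟨a, j, req, ha, by omega, h, h2, h3⟩

theorem exists_handles_of_replies {i : Fin N} {r : Rec K C} {j : ℕ}
    (h : (E.cl c j).replies i = some r) :
    ∃ a b req, a < b ∧ b < j ∧ E.Sends c i (E.cl c j).seq req a ∧ E.Handles i req r b := by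
  induction j with
  | zero => simp [cl_zero] at h
  | succ j ih =>
    rcases (E.clientStep c j).seq_replies with ⟨h1, -, -, h2⟩ | ⟨-, h1⟩
    · rw [h1]
      have : ∃ a b req, a < b ∧ b < j ∧ E.Sends c i (E.cl c j).seq req a ∧ E.Handles i req r b := by
        rcases h2 i r h with h2 | h2
        · exact ih h2
        · have h3 := E.step j
          rw [h2] at h3
          exact exists_handles_of_reply_mem h3.mem_net_of_deliver
      obtain ⟨a, b, req, hab, hb, h⟩ := this
      exact ⟨a, b, req, hab, by omega, h⟩
    · rw [h1] at h
      cases h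

/-- A reply to a client in the middle of an operation answers the request of its phase and was
sent after the beginning of the phase. -/
theorem exists_handles {i : Fin N} {r : Rec K C} {j : ℕ} (hp : (E.cl c j).phase ≠ .idle)
    (h : (E.cl c j).replies i = some r) :
    ∃ a b req, E.lastInv c j ≤ a ∧ a < b ∧ b < j ∧ (E.cl c (a + 1)).phase = (E.cl c j).phase ∧
      (E.cl c j).phase.request α i = some req ∧ E.Handles i req r b := by
  obtain ⟨a, b, req, hab, hbj, ⟨-, h1, h2⟩, h3⟩ := exists_handles_of_replies h
  -- The access number in the reply is still current, so no phase has begun since the request was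
  -- sent.
  obtain ⟨h4, h5⟩ := phase_of_seq_eq (E := E) (c := c) (show a + 1 ≤ j by omega) h1.symm
  have h6 := h4.resolve_right hp
  exact ⟨a, b, req, h5 ▸ lastInv_le a, hab, hbj, h6.symm, h6 ▸ h2, h3⟩

/-! ### Storages only grow -/

theorem hasFin_mono {i : Fin N} {t : Tag C} {j j' : ℕ} (hj : j ≤ j')
    (h : HasFin ((E.state j).storage i) t) : HasFin ((E.state j').storage i) t := by
  induction j', hj using Nat.le_induction with
  | base => exact h
  | succ j' hj ih =>
    rcases (E.step j').storage_eq i with h1 | ⟨_, _, _, _, h1⟩ | ⟨_, _, _, h1⟩ <;> rw [h1]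
    exacts [ih, ih.storageAfter _, ih.storageAfterGossip _]

theorem hasShare_mono {i : Fin N} {t : Tag C} {j j' : ℕ} (hj : j ≤ j')
    (h : HasShare ((E.state j).storage i) t) : HasShare ((E.state j').storage i) t := by
  induction j', hj using Nat.le_induction with
  | base => exact h
  | succ j' hj ih =>
    rcases (E.step j').storage_eq i with h1 | ⟨_, _, _, _, h1⟩ | ⟨_, _, _, h1⟩ <;> rw [h1]
    exacts [ih, ih.storageAfter _, ih.storageAfterGossip _]

theorem Finalized.mono {j j' : ℕ} {t : Tag C} {m : Fin k → K} (h : E.Finalized j t m)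
    (hj : j ≤ j') : E.Finalized j' t m :=
  h.imp id fun ⟨n, hn, h⟩ => ⟨n, hn.trans_le hj, h⟩

/-! ### The order of tags -/

variable (E) in
/-- At time `j`, a quorum has finalized tag `t`. -/
def FinQuorum (j : ℕ) (t : Tag C) : Prop :=
  ∃ Q : Finset (Fin N), quorumSize N k e ≤ Q.card ∧ ∀ i ∈ Q, HasFin ((E.state j).storage i) t

theorem FinQuorum.mono {j j' : ℕ} {t : Tag C} (h : E.FinQuorum j t) (hj : j ≤ j') :
    E.FinQuorum j' t :=
  h.imp fun _ h => ⟨h.1, fun i hi => hasFin_mono hj (h.2 i hi)⟩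

theorem finQuorum_of_hasQuorum {j : ℕ} {t : Tag C} (hq : (E.cl c j).HasQuorum e)
    (h : (∃ m, (E.cl c j).phase = .wFin m t) ∨ (E.cl c j).phase = .rFin t) :
    E.FinQuorum j t := by
  classical
  refine ⟨_, hq, fun i hi => ?_⟩
  obtain ⟨r, hr⟩ := Option.ne_none_iff_exists'.1 (Finset.mem_filter.1 hi).2
  have hp : (E.cl c j).phase ≠ .idle := by
    rcases h with ⟨m, h⟩ | h <;> simp [h]
  obtain ⟨a, b, req, -, -, hb, -, h2, h3, -⟩ := exists_handles hp hr
  refine hasFin_mono (show b + 1 ≤ j by omega) ?_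
  rw [h3]
  rcases h with ⟨m, h⟩ | h <;> rw [h] at h2 <;> cases h2
  exacts [hasFin_storageAfter_finW _ _, hasFin_storageAfter_finR _ _]

/-- Some server lies in both quorums. It handled the query after the invocation, hence with `t`
already labelled `fin`, and even a malicious server reports its highest finalized tag truthfully. -/
theorem le_maxTag_of_finQuorum {j : ℕ} {t : Tag C} (hq : (E.cl c j).HasQuorum e)
    (h : (∃ m, (E.cl c j).phase = .wQry m) ∨ (E.cl c j).phase = .rQry)
    (ht : E.FinQuorum (E.lastInv c j) t) : t ≤ (E.cl c j).maxTag := by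
  classical
  obtain ⟨Q, hQ, hQt⟩ := ht
  have h1 := le_card_inter_of_quorums hQ hq
  have h2 : 0 < k + 2 * e := Nat.add_pos_left (NeZero.pos k) _
  obtain ⟨i, hi⟩ := Finset.card_pos.1 (h2.trans_le h1)
  obtain ⟨hiQ, hi⟩ := Finset.mem_inter.1 hi
  obtain ⟨r, hr⟩ := Option.ne_none_iff_exists'.1 (Finset.mem_filter.1 hi).2
  have hp : (E.cl c j).phase ≠ .idle := by
    rcases h with ⟨m, h⟩ | h <;> simp [h]
  obtain ⟨a, b, req, ha, hab, hb, -, h2, -, h3⟩ := exists_handles hp hr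
  have hreq : req = .qry := by
    rcases h with ⟨m, h⟩ | h <;> rw [h] at h2 <;> cases h2 <;> rfl
  subst hreq
  have h4 : r.tag = maxFin ((E.state b).storage i) := h3.tag_eq
  calc t ≤ maxFin ((E.state b).storage i) :=
        (hasFin_mono (show E.lastInv c j ≤ b by omega) (hQt i hiQ)).le_maxFin
    _ = ((E.cl c j).replies i).elim ⊥ Rec.tag := by rw [hr, ← h4]; rfl
    _ ≤ (E.cl c j).maxTag :=
        Finset.le_sup (f := fun i => ((E.cl c j).replies i).elim ⊥ Rec.tag) (Finset.mem_univ i)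

/-- The tag of an operation is at least every tag that a quorum had finalized before its
invocation. -/
theorem le_tag {j : ℕ} {t u : Tag C} (ht : (E.cl c j).phase.tag = some t)
    (hu : E.FinQuorum (E.lastInv c j) u) :
    u ≤ t ∧ ((E.cl c j).phase.message ≠ none → u < t) := by
  induction j with
  | zero => simp [cl_zero, Phase.tag] at ht
  | succ j ih =>
    obtain ⟨h1, h2, h3⟩ := (E.clientStep c j).of_tag ht
    rw [lastInv_succ_of_not_isInv h1] at hu
    rcases h3 with h3 | ⟨h3, m, h4, h5, rfl⟩ | ⟨h3, h4, h5, rfl⟩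
    · rw [h2]
      exact ih h3 hu
    · have := (le_maxTag_of_finQuorum h3 (Or.inl ⟨m, h4⟩) hu).trans_lt (Tag.lt_next _ c)
      exact ⟨this.le, fun _ => this⟩
    · exact ⟨le_maxTag_of_finQuorum h3 (Or.inr h4) hu, fun h => by simp [h5, Phase.message] at h⟩

/-- Writes of different clients are told apart by the second component of their tags. -/
theorem exists_eq_of_write_tag {j : ℕ} {t : Tag C} (ht : (E.cl c j).phase.tag = some t)
    (hm : (E.cl c j).phase.message ≠ none) : ∃ z : ℕ+, t = ((toLex (z, c) : ℕ+ ×ₗ C) : Tag C) := by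
  induction j with
  | zero => simp [cl_zero, Phase.tag] at ht
  | succ j ih =>
    obtain ⟨h1, h2, h3⟩ := (E.clientStep c j).of_tag ht
    rcases h3 with h3 | ⟨h3, m, h4, h5, rfl⟩ | ⟨h3, h4, h5, rfl⟩
    · exact ih h3 (h2 ▸ hm)
    · exact ⟨_, rfl⟩
    · simp [h5, Phase.message] at hm

/-- After a client has chosen the tag of a write, it continues with this write until a quorum has
finalized the tag. -/
theorem finQuorum_lastInv {i j : ℕ} (hij : i ≤ j) {t : Tag C} {m : Fin k → K}
    (ht : (E.cl c i).phase.tag = some t) (hm : (E.cl c i).phase.message = some m) :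
    E.lastInv c j = E.lastInv c i ∨ E.FinQuorum (E.lastInv c j) t := by
  -- The induction also records the finalizing quorum at time `j` itself, so that the next
  -- invocation inherits it.
  have : (E.lastInv c j = E.lastInv c i ∧ (E.cl c j).phase.tag = some t ∧
      (E.cl c j).phase.message = some m) ∨ E.FinQuorum j t ∧
      (E.lastInv c j = E.lastInv c i ∨ E.FinQuorum (E.lastInv c j) t) := by
    induction j, hij using Nat.le_induction with
    | base => exact Or.inl ⟨rfl, ht, hm⟩
    | succ j hij ih =>
      rcases ih with ⟨h1, h2, h3⟩ | ⟨h1, h2⟩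
      · obtain ⟨h4, h5⟩ := (E.clientStep c j).of_write_tag h2 h3
        rw [lastInv_succ_of_not_isInv h4]
        rcases h5 with h5 | ⟨h5, h6⟩
        · exact Or.inl ⟨h1, h5⟩
        · exact Or.inr ⟨(finQuorum_of_hasQuorum h5 (Or.inl ⟨m, h6⟩)).mono j.le_succ, Or.inl h1⟩
      · refine Or.inr ⟨h1.mono j.le_succ, ?_⟩
        by_cases h4 : (E.act j).IsInv c
        · rw [lastInv_succ_of_isInv h4]
          exact Or.inr h1
        · rw [lastInv_succ_of_not_isInv h4]
          exact h2
  tauto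

/-- Different writes have different tags. -/
theorem write_tag_injective {c' : C} {i j : ℕ} {t : Tag C} {m m' : Fin k → K}
    (ht : (E.cl c i).phase.tag = some t) (hm : (E.cl c i).phase.message = some m)
    (ht' : (E.cl c' j).phase.tag = some t) (hm' : (E.cl c' j).phase.message = some m') :
    c' = c ∧ E.lastInv c' j = E.lastInv c i ∧ m' = m := by
  obtain ⟨z, hz⟩ := exists_eq_of_write_tag ht (by simp [hm])
  obtain ⟨z', hz'⟩ := exists_eq_of_write_tag ht' (by simp [hm'])
  obtain rfl : c' = c := by
    have := WithBot.coe_injective (hz'.symm.trans hz)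
    exact (Prod.mk.inj (toLex.injective this)).2
  have key : ∀ {i j : ℕ} {m m' : Fin k → K}, i ≤ j →
      (E.cl c' i).phase.tag = some t → (E.cl c' i).phase.message = some m →
      (E.cl c' j).phase.tag = some t → (E.cl c' j).phase.message = some m' →
      E.lastInv c' j = E.lastInv c' i := by
    intro i j m m' hij h1 h2 h3 h4
    -- If the write at `j` were a later operation, `t` would have been finalized by a quorum before
    -- its invocation, and its tag would exceed `t`.
    refine (finQuorum_lastInv hij h1 h2).resolve_right fun h => ?_
    exact lt_irrefl _ ((le_tag h3 h).2 (by simp [h4]))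
  have heq : E.lastInv c' j = E.lastInv c' i := by
    rcases le_total i j with h | h
    · exact key h ht hm ht' hm'
    · exact (key h ht' hm' ht hm).symm
  refine ⟨rfl, heq, ?_⟩
  have h1 := (lastInv_spec (Phase.ne_idle_of_tag ht)).2.1
  have h2 := (lastInv_spec (Phase.ne_idle_of_tag ht')).2.1
  rw [Phase.invocation_of_message c' hm] at h1
  rw [Phase.invocation_of_message c' hm', heq, ← h1] at h2
  simpa using h2

end Execution

namespace Execution

variable {N k : ℕ} [NeZero k] {K C : Type*} [Field K] [LinearOrder C]
  {α : Fin N → K} {e : ℕ} {m₀ : Fin k → K} {M : Finset (Fin N)} {E : Execution C α e m₀ M} {c : C}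

/-! ### Finalized tags -/

/-- The finalized records and the gossip at time `j` and the tags selected by readers belong to
writes that have reached their finalize phase. -/
theorem exists_finalized (j : ℕ) :
    (∀ i t, HasFin ((E.state j).storage i) t → ∃ m, E.Finalized j t m) ∧
      (∀ i l t, Msg.gossip i l t ∈ (E.state j).net → ∃ m, E.Finalized j t m) ∧
      ∀ c t, (E.cl c j).phase = .rFin t → ∃ m, E.Finalized j t m := by
  -- Strong induction is needed because finalize requests and query replies refer back to
  -- arbitrarily early states.
  induction j using Nat.strong_induction_on with
  | _ j ih =>
  rcases j with - | j
  · refine ⟨fun i t ⟨w, h⟩ => ?_, fun i l t h => ?_, fun c t h => ?_⟩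
    · simp only [E.init, initState, Finset.mem_singleton, Rec.mk.injEq] at h
      exact ⟨m₀, Or.inl ⟨h.1, rfl⟩⟩
    · simp [E.init, initState] at h
    · simp [cl_zero] at h
  · have mono : ∀ {t}, (∃ m, E.Finalized j t m) → ∃ m, E.Finalized (j + 1) t m :=
      fun ⟨m, h⟩ => ⟨m, h.mono j.le_succ⟩
    obtain ⟨i1, i2, i3⟩ := ih j j.lt_succ_self
    have hreq : ∀ {c : C} {i : Fin N} {q req t}, Msg.request c i q req ∈ (E.state j).net →
        req = .finW t ∨ req = .finR t → ∃ m, E.Finalized (j + 1) t m := by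
      intro c i q req t h ht
      obtain ⟨a, ha, -, -, h3⟩ := exists_sends_of_request_mem h
      rcases hph : (E.cl c (a + 1)).phase with _ | m | ⟨m, u⟩ | ⟨m, u⟩ | _ | u <;>
        rw [hph] at h3 <;> cases h3 <;> simp at ht
      · subst ht
        exact ⟨m, Or.inr ⟨a + 1, by omega, c, hph⟩⟩
      · subst ht
        obtain ⟨m, hm⟩ := (ih (a + 1) (by omega)).2.2 c u hph
        exact ⟨m, hm.mono (by omega)⟩
    refine ⟨fun i t ⟨w, h⟩ => ?_, fun i l t h => ?_, fun c t h => ?_⟩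
    · rcases (E.step j).storage_eq i with h1 | ⟨c, q, req, h1, h2⟩ | ⟨l, u, h1, h2⟩
      · rw [h1] at h
        exact mono (i1 i t ⟨w, h⟩)
      · rw [h2] at h
        rcases mem_storageAfter h with ⟨d, h3, rfl | ⟨-, h4⟩⟩ | ⟨w', -, -, h4⟩ | ⟨-, -, h4⟩
        · exact mono (i1 i t ⟨w, h3⟩)
        · exact hreq h1 h4
        · cases h4
        · exact hreq h1 h4
      · rw [h2] at h
        rcases mem_storageAfterGossip h with ⟨d, h3, rfl | ⟨-, h4⟩⟩ | ⟨-, -, h4⟩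
        · exact mono (i1 i t ⟨w, h3⟩)
        · obtain rfl : t = u := h4
          exact mono (i2 l i t h1)
        · obtain rfl : t = u := h4
          exact mono (i2 l i t h1)
    · rcases (E.step j).gossip_mem h with h | ⟨c, i', q, req, h1, h2⟩
      · exact mono (i2 i l t h)
      · exact hreq h1 h2
    · obtain ⟨-, h2, h3⟩ := (E.clientStep c j).of_tag (t := t) (by rw [h]; rfl)
      rcases h3 with h3 | ⟨h3, m, h4, h5, rfl⟩ | ⟨h3, h4, h5, rfl⟩
      · refine mono (i3 c t ?_)
        rcases hph : (E.cl c j).phase with _ | m | ⟨m, u⟩ | ⟨m, u⟩ | _ | u <;>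
          rw [hph, h] at h2 <;> rw [hph] at h3 <;> cases h2 <;> cases h3
        rfl
      · rw [h] at h5
        cases h5
      -- A reader's tag is the default one or the highest finalized tag of some storage at an
      -- earlier time.
      · rcases (E.cl c j).exists_maxTag_eq with h6 | ⟨i, r, hr, h6⟩
        · exact ⟨m₀, Or.inl ⟨h6, rfl⟩⟩
        · obtain ⟨a, b, req, -, -, hb, -, h7, -, h8⟩ := exists_handles (by simp [h4]) hr
          rw [h4] at h7
          cases h7
          have h9 : r.tag = maxFin ((E.state b).storage i) := h8.tag_eq
          rw [h6, h9]
          rcases hasFin_maxFin ((E.state b).storage i) with h10 | h10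
          · exact ⟨m₀, Or.inl ⟨h10, rfl⟩⟩
          · obtain ⟨m, hm⟩ := (ih b (by omega)).1 i _ h10
            exact ⟨m, hm.mono (by omega)⟩

/-- Records without a coded element are finalized. -/
theorem hasFin_of_none_mem {j : ℕ} {i : Fin N} {t : Tag C} {d : Label}
    (h : ⟨t, none, d⟩ ∈ (E.state j).storage i) : HasFin ((E.state j).storage i) t := by
  suffices hd : d = .fin by
    subst hd
    exact ⟨_, h⟩
  induction j generalizing t d with
  | zero => simp [E.init, initState] at h
  | succ j ih =>
    rcases (E.step j).storage_eq i with h1 | ⟨c, q, req, h1, h2⟩ | ⟨l, u, h1, h2⟩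
    · rw [h1] at h
      exact ih h
    · rw [h2] at h
      rcases mem_storageAfter h with ⟨d', h3, h4 | ⟨h4, -⟩⟩ | ⟨w', -, h4, -⟩ | ⟨-, h4, -⟩
      · exact h4.trans (ih h3)
      · exact h4
      · cases h4
      · exact h4
    · rw [h2] at h
      rcases mem_storageAfterGossip h with ⟨d', h3, h4 | ⟨h4, -⟩⟩ | ⟨-, h4, -⟩
      · exact h4.trans (ih h3)
      · exact h4
      · exact h4

/-- Every stored coded element has been pre-written. -/
theorem origin_of_share_mem {j : ℕ} {i : Fin N} {t : Tag C} {w : K} {d : Label}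
    (h : ⟨t, some w, d⟩ ∈ (E.state j).storage i) :
    (t = ⊥ ∧ w = encode α m₀ i) ∨
      ∃ c n m, (E.cl c n).phase = .wPre m t ∧ w = encode α m i := by
  induction j generalizing t d with
  | zero =>
    simp only [E.init, initState, Finset.mem_singleton, Rec.mk.injEq, Option.some.injEq] at h
    exact Or.inl ⟨h.1, h.2.1⟩
  | succ j ih =>
    rcases (E.step j).storage_eq i with h1 | ⟨c, q, req, h1, h2⟩ | ⟨l, u, h1, h2⟩
    · rw [h1] at h
      exact ih h
    · rw [h2] at h
      rcases mem_storageAfter h with ⟨d', h3, -⟩ | ⟨w', h4, h5, -⟩ | ⟨h4, -, -⟩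
      · exact ih h3
      · right
        obtain ⟨a, ha, -, -, h3⟩ := exists_sends_of_request_mem h1
        subst h4
        obtain rfl : w = w' := Option.some.inj h5
        rcases hph : (E.cl c (a + 1)).phase with _ | m | ⟨m, u⟩ | ⟨m, u⟩ | _ | u <;>
          rw [hph] at h3 <;> cases h3
        exact ⟨c, a + 1, m, hph, rfl⟩
      · cases h4
    · rw [h2] at h
      rcases mem_storageAfterGossip h with ⟨d', h3, -⟩ | ⟨h4, -, -⟩
      · exact ih h3
      · cases h4

theorem hasShare_bot (j : ℕ) (i : Fin N) : HasShare ((E.state j).storage i) ⊥ := by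
  refine hasShare_mono (Nat.zero_le j) ⟨encode α m₀ i, .fin, ?_⟩
  simp [E.init, initState]

/-- A tag that was selected by a write is not the default tag. -/
theorem write_tag_ne_bot {j : ℕ} {t : Tag C} (ht : (E.cl c j).phase.tag = some t)
    (hm : (E.cl c j).phase.message ≠ none) : t ≠ ⊥ := by
  obtain ⟨z, rfl⟩ := exists_eq_of_write_tag ht hm
  exact WithBot.coe_ne_bot

/-- When a write reaches its finalize phase, a quorum stores coded elements with its tag. -/
theorem exists_quorum_of_wFin {j : ℕ} {t : Tag C} {m : Fin k → K}
    (h : (E.cl c j).phase = .wFin m t) : ∃ Q : Finset (Fin N), quorumSize N k e ≤ Q.card ∧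
      ∀ i ∈ Q, HasShare ((E.state j).storage i) t := by
  classical
  induction j with
  | zero => simp [cl_zero] at h
  | succ j ih =>
    rcases (E.clientStep c j).of_wFin h with h1 | ⟨hq, h1⟩
    · obtain ⟨Q, hQ, h2⟩ := ih h1
      exact ⟨Q, hQ, fun i hi => hasShare_mono j.le_succ (h2 i hi)⟩
    · refine ⟨_, hq, fun i hi => ?_⟩
      obtain ⟨r, hr⟩ := Option.ne_none_iff_exists'.1 (Finset.mem_filter.1 hi).2
      have hp : (E.cl c j).phase ≠ .idle := by simp [h1]
      obtain ⟨a, b, req, -, -, hb, -, h2, h3, -⟩ := exists_handles hp hr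
      refine hasShare_mono (show b + 1 ≤ j + 1 by omega) ?_
      rw [h1] at h2
      cases h2
      rw [h3]
      simp only [storageAfter]
      split_ifs with h4
      · obtain ⟨⟨t', w, d⟩, h5, h6⟩ := h4
        obtain rfl : t' = t := h6
        cases w with
        | some w => exact ⟨w, d, h5⟩
        | none =>
          -- A record with `⊥` is finalized, so a write with this tag was already in its finalize
          -- phase. By injectivity it is the present write, which is still pre-writing, and phases
          -- never go back.
          exfalso
          have ht : (E.cl c j).phase.tag = some t' := by rw [h1]; rfl
          have hm : (E.cl c j).phase.message = some m := by rw [h1]; rfl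
          obtain ⟨m', ⟨h7, -⟩ | ⟨n, hn, c', h7⟩⟩ :=
            (exists_finalized b).1 i t' (hasFin_of_none_mem h5)
          · exact write_tag_ne_bot ht (by simp [hm]) h7
          · obtain ⟨rfl, h8, -⟩ := write_tag_injective (i := n) (c := c') (m := m')
              (by rw [h7]; rfl) (by rw [h7]; rfl) ht hm
            have h9 := (phase_of_lastInv_eq (show n ≤ j by omega) (by simp [h7]) h8).1
            rw [h7, h1] at h9
            simp [Phase.remaining] at h9
      · exact ⟨_, _, Finset.mem_insert_self _ _⟩

/-- For the default tag the set of all servers serves, which is a quorum only by `hN`. -/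
theorem Finalized.exists_quorum {n : ℕ} {t : Tag C} {m : Fin k → K} (h : E.Finalized n t m)
    (hN : quorumSize N k e ≤ N) : ∃ Q : Finset (Fin N), quorumSize N k e ≤ Q.card ∧
      ∀ i ∈ Q, HasShare ((E.state n).storage i) t := by
  rcases h with ⟨rfl, -⟩ | ⟨n', hn, c, h⟩
  · exact ⟨Finset.univ, by simpa using hN, fun i _ => hasShare_bot n i⟩
  · obtain ⟨Q, hQ, h⟩ := exists_quorum_of_wFin h
    exact ⟨Q, hQ, fun i hi => hasShare_mono hn.le (h i hi)⟩

/-- All stored coded elements with a finalized tag come from the same message vector. -/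
theorem Finalized.share_eq {n j : ℕ} {t : Tag C} {m : Fin k → K} (h : E.Finalized n t m)
    {i : Fin N} {w : K} {d : Label} (hw : ⟨t, some w, d⟩ ∈ (E.state j).storage i) :
    w = encode α m i := by
  rcases h with ⟨rfl, rfl⟩ | ⟨n', hn, c, h⟩ <;>
    rcases origin_of_share_mem hw with ⟨h1, h2⟩ | ⟨c', n2, m', h1, h2⟩
  · exact h2
  · exact absurd rfl (write_tag_ne_bot (E := E) (c := c') (j := n2) (by rw [h1]; rfl)
      (by simp [h1, Phase.message]))
  · exact absurd h1 (write_tag_ne_bot (E := E) (c := c) (j := n') (by rw [h]; rfl)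
      (by simp [h, Phase.message]))
  · rw [h2, (write_tag_injective (E := E) (c := c) (c' := c') (i := n') (j := n2) (m := m)
      (m' := m') (t := t) (by rw [h]; rfl) (by rw [h]; rfl) (by rw [h1]; rfl)
      (by rw [h1]; rfl)).2.2]

/-! ### Reads -/

/-- A read in its finalize phase that has heard from a quorum has received enough coded
elements, all of them correct except for those of malicious servers. -/
theorem read_shares {n : ℕ} {t : Tag C} (hp : (E.cl c n).phase = .rFin t)
    (hq : (E.cl c n).HasQuorum e) : ∃ m, E.Finalized n t m ∧
      k + 2 * e ≤ numReceived ((E.cl c n).shares t) ∧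
      numCorrupted α m ((E.cl c n).shares t) ≤ M.card := by
  classical
  obtain ⟨m, hm⟩ := (exists_finalized n).2.2 c t hp
  have hN : quorumSize N k e ≤ N :=
    hq.trans ((Finset.card_le_univ _).trans_eq (Fintype.card_fin N))
  have hp' : (E.cl c n).phase ≠ .idle := by simp [hp]
  have key : ∀ i r, (E.cl c n).replies i = some r → ∃ b, (E.cl c n).shares t i = r.data ∧
      (∃ a < b, (E.cl c (a + 1)).phase = .rFin t) ∧
      ValidReply M ((E.state b).storage i) i (.finR t) r := by
    intro i r hr
    obtain ⟨a, b, req, -, hab, hb, h1, h2, h3⟩ := exists_handles hp' hr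
    rw [hp] at h2 h1
    cases h2
    exact ⟨b, Client.shares_eq hr h3.2.tag_eq h3.2.label_eq, ⟨a, hab, h1⟩, h3.2⟩
  refine ⟨m, hm, ?_, Finset.card_le_card fun i hi => ?_⟩
  -- One quorum must serve for all replies, although each was sent at its own time. It is taken at
  -- the first moment when this client was finalizing a read of `t`, which precedes all of them.
  · have hcommon : ∃ Q : Finset (Fin N), quorumSize N k e ≤ Q.card ∧
        ∀ i ∈ Q, ∀ b, (∃ a < b, (E.cl c (a + 1)).phase = .rFin t) →
          HasShare ((E.state b).storage i) t := by
      by_cases hex : ∃ a, (E.cl c (a + 1)).phase = .rFin t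
      · have hspec := Nat.find_spec hex
        obtain ⟨m', hm'⟩ := (exists_finalized _).2.2 c t hspec
        obtain ⟨Q, hQ, h⟩ := hm'.exists_quorum hN
        refine ⟨Q, hQ, fun i hi b ⟨a, hab, ha⟩ => hasShare_mono ?_ (h i hi)⟩
        have := Nat.find_min' hex ha
        omega
      · exact ⟨Finset.univ, by simpa using hN, fun i _ b ⟨a, _, ha⟩ => absurd ⟨a, ha⟩ hex⟩
    obtain ⟨Q, hQ, hcommon⟩ := hcommon
    refine (le_card_inter_of_quorums hQ hq).trans (Finset.card_le_card fun i hi => ?_)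
    obtain ⟨hiQ, hi⟩ := Finset.mem_inter.1 hi
    obtain ⟨r, hr⟩ := Option.ne_none_iff_exists'.1 (Finset.mem_filter.1 hi).2
    obtain ⟨b, h1, h2, h3⟩ := key i r hr
    refine Finset.mem_filter.2 ⟨Finset.mem_univ _, ?_⟩
    rw [h1]
    exact h3.data_ne_none (hcommon i hiQ b h2).storedShare_ne_none
  -- A server outside `M` sends its stored share, and every stored share of a finalized tag comes
  -- from `m`.
  · obtain ⟨-, h1, h2⟩ := Finset.mem_filter.1 hi
    by_contra hiM
    cases hr : (E.cl c n).replies i with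
    | none => exact h1 (by simp [Client.shares, hr])
    | some r =>
      obtain ⟨b, h3, -, h4 | ⟨h4, -⟩⟩ := key i r hr
      · have h5 : r.data = storedShare ((E.state b).storage i) t := by rw [h4]; rfl
        rw [h3] at h1 h2
        obtain ⟨w, hw⟩ := Option.ne_none_iff_exists'.1 h1
        obtain ⟨d, hd⟩ := storedShare_mem (h5.symm.trans hw)
        rw [hw, hm.share_eq hd] at h2
        exact h2 rfl
      · exact hiM h4

/-- What a read returns. -/
theorem read_spec (hα : Function.Injective α) (hM : M.card ≤ e) {n : ℕ} {v : Option K}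
    (h : E.act n = .retRead c v) :
    ∃ t m, (E.cl c n).phase = .rFin t ∧ E.Finalized n t m ∧
      k + 2 * e ≤ numReceived ((E.cl c n).shares t) ∧
      numCorrupted α m ((E.cl c n).shares t) ≤ e ∧
      berlekampWelch α k e ((E.cl c n).shares t) = some m ∧ v = some (secret m) := by
  have ha : (E.act n).IsRet c := Or.inr ⟨v, h⟩
  obtain ⟨hq, -, ⟨m, t, -, h1⟩ | ⟨t, hp, h1⟩⟩ := (E.clientStep c n).of_isRet ha
  · rw [h] at h1
    cases h1
  · obtain ⟨m, h2, h3, h4⟩ := read_shares hp hq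
    have h5 := berlekampWelch_eq hα h3 (h4.trans hM)
    refine ⟨t, m, hp, h2, h3, h4.trans hM, h5, ?_⟩
    rw [h] at h1
    cases h1
    rw [Client.readResult, if_pos h3, h5]
    rfl

end Execution

/-! ### Auxiliary facts on actions and sorted lists -/

theorem Action.IsInv.eq {N k : ℕ} {K C : Type*} {a : Action N k K C} {c c' : C}
    (h : a.IsInv c) (h' : a.IsInv c') : c = c' := by
  rcases h with rfl | ⟨m, rfl⟩ <;> rcases h' with h' | ⟨m', h'⟩ <;> cases h' <;> rfl

theorem Action.IsRet.eq {N k : ℕ} {K C : Type*} {a : Action N k K C} {c c' : C}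
    (h : a.IsRet c) (h' : a.IsRet c') : c = c' := by
  rcases h with rfl | ⟨m, rfl⟩ <;> rcases h' with h' | ⟨m', h'⟩ <;> cases h' <;> rfl

theorem exists_sorted_list {β : Type*} [LinearOrder β] (S : Finset ℕ) (key : ℕ → β) (g : β → ℕ)
    (hg : Function.LeftInverse g key) :
    ∃ L : List ℕ, (∀ n, n ∈ L ↔ n ∈ S) ∧ L.Pairwise fun a b => key a < key b := by
  refine ⟨((S.image key).sort).map g, fun n => ?_, ?_⟩
  · simp only [List.mem_map, Finset.mem_sort, Finset.mem_image, exists_exists_and_eq_and]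
    simp [hg _]
  · rw [List.pairwise_map]
    refine ((S.image key).sortedLT_sort.pairwise).imp_of_mem fun {a b} ha hb hab => ?_
    obtain ⟨x, -, rfl⟩ := Finset.mem_image.1 ((Finset.mem_sort _).1 ha)
    obtain ⟨y, -, rfl⟩ := Finset.mem_image.1 ((Finset.mem_sort _).1 hb)
    rwa [hg, hg]

namespace Execution

variable {N k : ℕ} [NeZero k] {K C : Type*} [Field K] [LinearOrder C]
  {α : Fin N → K} {e : ℕ} {m₀ : Fin k → K} {M : Finset (Fin N)} {E : Execution C α e m₀ M} {c : C}

/-! ### Termination -/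

/-- If a client does not continue its operation, it keeps the replies it has received. -/
theorem replies_of_not_continue {j j' : ℕ} (hp : (E.cl c j).phase ≠ .idle) (hj : j ≤ j')
    (h : ∀ l, j ≤ l → l < j' → E.act l ≠ .advance c ∧ ¬ (E.act l).IsRet c) :
    (E.cl c j').seq = (E.cl c j).seq ∧ (E.cl c j').phase = (E.cl c j).phase ∧
      ∀ i, (E.cl c j).replies i ≠ none → (E.cl c j').replies i ≠ none := by
  induction j', hj using Nat.le_induction with
  | base => exact ⟨rfl, rfl, fun i => id⟩
  | succ j' hj ih =>
    obtain ⟨h1, h2, h3⟩ := ih fun l hl hl' => h l hl (by omega)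
    obtain ⟨h4, h5⟩ := h j' hj j'.lt_succ_self
    obtain ⟨h6, h7, h8⟩ := (E.clientStep c j').replies_of_continue h5 h4 (h2 ▸ hp)
    exact ⟨h6.trans h1, h7.trans h2, fun i hi => h8 i (h3 i hi)⟩

/-- A correct client that has sent its requests eventually continues. -/
theorem Fair.exists_continue {f : ℕ} (hE : E.Fair) (hf : E.CrashesAtMost f)
    (hN : k + 2 * (f + e) ≤ N) (hc : .inr c ∉ E.faulty) {j : ℕ}
    (hp : (E.cl c j).phase ≠ .idle)
    (hreq : ∀ i, ∃ req, Msg.request c i (E.cl c j).seq req ∈ (E.state j).net) :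
    ∃ j' ≥ j, E.act j' = .advance c ∨ (E.act j').IsRet c := by
  classical
  by_contra! hno
  have hkeep : ∀ {l l'}, j ≤ l → l ≤ l' → (E.cl c l').seq = (E.cl c l).seq ∧
      (E.cl c l').phase = (E.cl c l).phase ∧
      ∀ i, (E.cl c l).replies i ≠ none → (E.cl c l').replies i ≠ none := by
    intro l l' hl hl'
    have h1 := (replies_of_not_continue hp hl fun x hx _ => hno x hx).2.1
    exact replies_of_not_continue (h1 ▸ hp) hl' fun x hx _ => hno x (hl.trans hx)
  -- For a faulty server any time will do; stating it for all servers lets `choose` give a total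
  -- function, whose maximum is then taken.
  have hreply : ∀ i, ∃ n ≥ j, .inl i ∉ E.faulty → (E.cl c n).replies i ≠ none := by
    intro i
    by_cases hi : .inl i ∈ E.faulty
    · exact ⟨j, le_rfl, fun h => absurd hi h⟩
    · obtain ⟨req, hreq⟩ := hreq i
      obtain ⟨n, hn, h1⟩ := hE.deliver j _ hreq hc hi
      have h2 := E.step n
      rw [h1] at h2
      obtain ⟨r, hr⟩ := h2.exists_reply_of_deliver_request
      obtain ⟨n', hn', h3⟩ := hE.deliver (n + 1) _ hr hi hc
      have h4 := E.step n'
      rw [h3, ← (hkeep le_rfl (show j ≤ n' by omega)).1] at h4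
      exact ⟨n' + 1, by omega, fun _ => h4.replies_of_deliver_reply⟩
  choose n hn hreply using hreply
  let J := max j (Finset.univ.sup n)
  have hquorum : (E.cl c J).HasQuorum e := by
    have h1 : Finset.univ.filter (fun i : Fin N => .inl i ∉ E.faulty) ⊆
        Finset.univ.filter fun i => (E.cl c J).replies i ≠ none := by
      intro i hi
      refine Finset.mem_filter.2 ⟨Finset.mem_univ i, ?_⟩
      refine (hkeep (hn i) ?_).2.2 i (hreply i (Finset.mem_filter.1 hi).2)
      exact (Finset.le_sup (Finset.mem_univ i)).trans (le_max_right _ _)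
    have h2 : (Finset.univ.filter fun i : Fin N => .inl i ∈ E.faulty).card ≤ f := by
      rw [← Set.ncard_coe_finset]
      simpa [CrashesAtMost] using hf
    have h3 := Finset.card_filter_add_card_filter_not
      (s := Finset.univ) (fun i : Fin N => Sum.inl i ∈ E.faulty)
    rw [Finset.card_univ, Fintype.card_fin] at h3
    refine le_trans (quorumSize_le ?_) (Finset.card_le_card h1)
    -- At most `f` servers are faulty, and `N + k + 2e ≤ 2(N - f)`.
    omega
  have hJ : j ≤ J := le_max_left _ _
  obtain ⟨n', hn', h⟩ := hE.progress J c hc ((hkeep le_rfl hJ).2.1 ▸ hp) hquorum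
  obtain ⟨h1, h2⟩ := hno n' (hJ.trans hn')
  tauto

theorem Fair.exists_isRet {f : ℕ} (hE : E.Fair) (hf : E.CrashesAtMost f)
    (hN : k + 2 * (f + e) ≤ N) (hc : .inr c ∉ E.faulty) {j : ℕ}
    (h : (E.act j).IsInv c ∨ E.act j = .advance c) : ∃ n > j, (E.act n).IsRet c := by
  -- Each continuation ends the operation or lowers the number of remaining phases. The first one is
  -- used, so that the phase is unchanged until then.
  induction hr : (E.cl c (j + 1)).phase.remaining using Nat.strong_induction_on generalizing j with
  | _ r ih =>
    obtain ⟨h1, h2⟩ := (E.step j).request_mem_of_phase h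
    classical
    have hex := hE.exists_continue hf hN hc h1 h2
    obtain ⟨hge, h3⟩ := Nat.find_spec hex
    have hkeep := (replies_of_not_continue h1 hge fun l hl hl' => by
      have := Nat.find_min hex hl'
      tauto).2.1
    rcases h3 with h3 | h3
    · have h4 := (E.clientStep c _).remaining_lt_of_advance h3
      rw [hkeep, hr] at h4
      obtain ⟨n, hn, h5⟩ := ih _ h4 (Or.inr h3) rfl
      exact ⟨n, by omega, h5⟩
    · exact ⟨_, by omega, h3⟩

theorem Fair.live {f : ℕ} (hE : E.Fair) (hf : E.CrashesAtMost f) (hN : k + 2 * (f + e) ≤ N) :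
    E.Live := by
  classical
  intro n c h hc
  have hex := hE.exists_isRet hf hN hc (Or.inl h)
  obtain ⟨h1, h2⟩ := Nat.find_spec hex
  refine ⟨Nat.find hex, c, h, h1, h2, fun j hj hj' h3 => ?_⟩
  exact Nat.find_min hex hj' ⟨hj, h3⟩

/-! ### Linearizability -/

/-- Until its return the client is not idle, so it cannot invoke another operation in between. -/
theorem Returns.lastInv_eq {n n' : ℕ} (h : E.Returns n n') (hc : (E.act n').IsRet c) :
    E.lastInv c n' = n := by
  obtain ⟨c', h1, h2, h3, h4⟩ := h
  obtain rfl := h3.eq hc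
  have : ∀ j, n + 1 ≤ j → j ≤ n' → (E.cl c' j).phase ≠ .idle ∧ E.lastInv c' j = n := by
    intro j hj
    induction j, hj using Nat.le_induction with
    | base =>
      exact fun _ => ⟨((E.clientStep c' n).phase_of_isInv h1).2.1, lastInv_succ_of_isInv h1⟩
    | succ j hj ih =>
      intro hj'
      obtain ⟨i1, i2⟩ := ih (by omega)
      have i3 : ¬ (E.act j).IsInv c' := fun h => i1 ((E.clientStep c' j).phase_of_isInv h).1
      exact ⟨(E.clientStep c' j).ne_idle (h4 j (by omega) (by omega)) i1,
        (lastInv_succ_of_not_isInv i3).trans i2⟩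
  exact (this n' h2 le_rfl).2

variable (E) in
/-- The operation invoked at time `n` selects tag `t`. -/
def OpTag (n : ℕ) (t : Tag C) : Prop :=
  ∃ c j, E.lastInv c j = n ∧ (E.cl c j).phase.tag = some t

theorem OpTag.isInv {n : ℕ} {t : Tag C} (h : E.OpTag n t) : ∃ c, (E.act n).IsInv c := by
  obtain ⟨c, j, rfl, h⟩ := h
  exact ⟨c, isInv_lastInv (Phase.ne_idle_of_tag h)⟩

/-- The invocation time determines the client, and a selected tag is kept until the operation ends.
-/
theorem OpTag.unique {n : ℕ} {t t' : Tag C} (h : E.OpTag n t) (h' : E.OpTag n t') : t = t' := by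
  obtain ⟨c, j, hj, ht⟩ := h
  obtain ⟨c', j', hj', ht'⟩ := h'
  have hp := Phase.ne_idle_of_tag ht
  have hp' := Phase.ne_idle_of_tag ht'
  have h1 := isInv_lastInv hp
  have h1' := isInv_lastInv hp'
  rw [hj] at h1
  rw [hj'] at h1'
  obtain rfl := h1.eq h1'
  rcases le_total j j' with h | h
  · have := ((phase_of_lastInv_eq h hp (hj'.trans hj.symm)).2 t ht).resolve_right hp'
    exact Option.some.inj (this.symm.trans ht')
  · have := ((phase_of_lastInv_eq h hp' (hj.trans hj'.symm)).2 t' ht').resolve_right hp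
    exact Option.some.inj (ht.symm.trans this)

theorem Returns.exists_opTag {n n' : ℕ} (h : E.Returns n n') :
    ∃ t, E.OpTag n t ∧ E.FinQuorum n' t := by
  have h0 := h
  obtain ⟨c, -, -, h3, -⟩ := h0
  have h4 := h.lastInv_eq h3
  obtain ⟨hq, -, ⟨m, t, h5, -⟩ | ⟨t, h5, -⟩⟩ := (E.clientStep c n').of_isRet h3
  · exact ⟨t, ⟨c, n', h4, by rw [h5]; rfl⟩, finQuorum_of_hasQuorum hq (Or.inl ⟨m, h5⟩)⟩
  · exact ⟨t, ⟨c, n', h4, by rw [h5]; rfl⟩, finQuorum_of_hasQuorum hq (Or.inr h5)⟩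

/-- Tags respect the real-time order of operations. -/
theorem OpTag.le_of_returns {a b b' : ℕ} {t u : Tag C} (hb : E.OpTag b u) (h : E.Returns b b')
    (hlt : b' < a) (ha : E.OpTag a t) :
    u ≤ t ∧ ((∃ c m, E.act a = .invWrite c m) → u < t) := by
  obtain ⟨u', hu', hq⟩ := h.exists_opTag
  obtain rfl := hb.unique hu'
  obtain ⟨c, j, rfl, ht⟩ := ha
  obtain ⟨h1, h2⟩ := le_tag ht (hq.mono hlt.le)
  refine ⟨h1, fun ⟨c', m, h3⟩ => h2 ?_⟩
  have h4 := (lastInv_spec (Phase.ne_idle_of_tag ht)).2.1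
  rw [h3] at h4
  simp [Phase.message_of_invocation h4]

variable (E) in
open Classical in
/-- Operations are ordered by their tags; operations with the same tag are ordered by their times
of invocation, with the write before the reads. -/
noncomputable def opKey (n : ℕ) : Tag C ×ₗ ℕ ×ₗ ℕ :=
  toLex (if h : ∃ t, E.OpTag n t then h.choose else ⊥,
    toLex (if ∃ c, E.act n = .invRead c then 1 else 0, n))

/-- Only operations with a tag are compared, so the default in `opKey` plays no role, and uniqueness
identifies the chosen tag. -/
theorem OpTag.opKey_lt_iff {a b : ℕ} {t u : Tag C} (ha : E.OpTag a t) (hb : E.OpTag b u) :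
    E.opKey a < E.opKey b ↔ t < u ∨ t = u ∧
      ((¬ ∃ c, E.act a = .invRead c) ∧ (∃ c, E.act b = .invRead c) ∨
        ((∃ c, E.act a = .invRead c) ↔ ∃ c, E.act b = .invRead c) ∧ a < b) := by
  have ha' : ∃ t, E.OpTag a t := ⟨t, ha⟩
  have hb' : ∃ t, E.OpTag b t := ⟨u, hb⟩
  rw [opKey, opKey, dif_pos ha', dif_pos hb', ha'.choose_spec.unique ha,
    hb'.choose_spec.unique hb]
  simp only [Prod.Lex.toLex_lt_toLex]
  by_cases h1 : ∃ c, E.act a = .invRead c <;> by_cases h2 : ∃ c, E.act b = .invRead c <;>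
    simp [h1, h2]

theorem foldl_apply_eq {L : List ℕ} (x : K)
    (h : ∀ j ∈ L, ∀ c m, E.act j ≠ .invWrite c m) :
    L.foldl (fun x j => (E.act j).apply x) x = x := by
  induction L with
  | nil => rfl
  | cons j L ih =>
    have h1 : (E.act j).apply x = x := by
      have := h j (List.mem_cons_self ..)
      cases hj : E.act j <;> first | rfl | exact absurd hj (this _ _)
    rw [List.foldl_cons, h1]
    exact ih fun i hi => h i (List.mem_cons_of_mem _ hi)

theorem message_of_invWrite {j : ℕ} {c' : C} {m : Fin k → K} {t : Tag C}
    (ht : (E.cl c j).phase.tag = some t) (h : E.act (E.lastInv c j) = .invWrite c' m) :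
    (E.cl c j).phase.message = some m := by
  have h4 := (lastInv_spec (Phase.ne_idle_of_tag ht)).2.1
  rw [h] at h4
  exact Phase.message_of_invocation h4

theorem linearizableUpTo (hα : Function.Injective α) (hM : M.card ≤ e) (T : ℕ) :
    E.LinearizableUpTo T := by
  classical
  -- A pending operation whose tag is selected only after `T` is listed too, which linearizability
  -- permits. The last component of the key recovers the operation.
  obtain ⟨L, hL, hsort⟩ := exists_sorted_list ((Finset.range T).filter fun n => ∃ t, E.OpTag n t)
    E.opKey (fun x => (ofLex (ofLex x).2).2) fun _ => rfl
  simp only [Finset.mem_filter, Finset.mem_range] at hL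
  have hmem : ∀ {n n'}, n' < T → E.Returns n n' → n ∈ L := by
    intro n n' hn' h
    obtain ⟨t, ht, -⟩ := h.exists_opTag
    obtain ⟨-, -, hlt, -⟩ := h
    exact (hL n).2 ⟨by omega, t, ht⟩
  refine ⟨L, hsort.imp fun h => ?_, fun n hn => ?_, fun n n' hn' h => hmem hn' h,
    hsort.imp_of_mem fun {a b} ha hb hab => ?_, ?_⟩
  · rintro rfl
    exact lt_irrefl _ h
  · obtain ⟨h1, t, h2⟩ := (hL n).1 hn
    exact ⟨h1, h2.isInv⟩
  · rintro ⟨b', hb', hlt⟩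
    obtain ⟨-, t, ht⟩ := (hL a).1 ha
    obtain ⟨-, u, hu⟩ := (hL b).1 hb
    have hbb' : b < b' := by
      obtain ⟨-, -, h, -⟩ := hb'
      exact h
    obtain ⟨h1, h2⟩ := hu.le_of_returns hb' hlt ht
    -- Here `b` returned before `a` was invoked: a smaller tag of `a` contradicts `u ≤ t`, an equal
    -- tag is impossible for a write `a`, and otherwise the times of invocation decide.
    rcases (ht.opKey_lt_iff hu).1 hab with h3 | ⟨rfl, ⟨h3, -⟩ | ⟨-, h3⟩⟩
    · exact h3.not_ge h1
    · obtain ⟨c, h4 | ⟨m, h4⟩⟩ := ht.isInv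
      · exact h3 ⟨c, h4⟩
      · exact lt_irrefl _ (h2 ⟨c, m, h4⟩)
    · omega
  · intro L₁ n L₂ hL₁ n' c v hn' hret hact
    obtain ⟨t, m, hp, hfin, -, -, -, rfl⟩ := read_spec hα hM hact
    have hinv : E.lastInv c n' = n := hret.lastInv_eq (Or.inr ⟨_, hact⟩)
    have hpt : (E.cl c n').phase.tag = some t := by rw [hp]; rfl
    have hread : E.act n = .invRead c := by
      have := (lastInv_spec (Phase.ne_idle_of_tag hpt)).2.1
      rw [hp, hinv] at this
      exact (Option.some.inj this).symm
    have hnt : E.OpTag n t := ⟨c, n', hinv, hpt⟩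
    rw [hL₁, List.pairwise_append] at hsort
    obtain ⟨hs1, hs2, hs3⟩ := hsort
    have hbefore : ∀ j ∈ L₁, E.opKey j < E.opKey n := fun j hj =>
      hs3 j hj n (List.mem_cons_self ..)
    have htag : ∀ j ∈ L₁, ∃ u, E.OpTag j u ∧ u ≤ t := by
      intro j hj
      obtain ⟨-, u, hu⟩ := (hL j).1 (by rw [hL₁]; exact List.mem_append_left _ hj)
      refine ⟨u, hu, ?_⟩
      rcases (hu.opKey_lt_iff hnt).1 (hbefore j hj) with h | ⟨h, -⟩
      exacts [h.le, h.le]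
    congr 1
    rcases hfin with ⟨rfl, rfl⟩ | ⟨n₁, hn₁, c₁, hw⟩
    -- Only operations with the default tag can precede a read of it, and none of them is a write.
    · refine (foldl_apply_eq _ fun j hj c' m' h => ?_).symm
      obtain ⟨u, ⟨c₂, i, rfl, h2⟩, hu⟩ := htag j hj
      refine write_tag_ne_bot h2 ?_ (le_bot_iff.1 hu)
      simp [message_of_invWrite h2 h]
    · have hwt : (E.cl c₁ n₁).phase.tag = some t := by rw [hw]; rfl
      have hwm : (E.cl c₁ n₁).phase.message = some m := by rw [hw]; rfl
      obtain ⟨hw1, hw2, -⟩ := lastInv_spec (Phase.ne_idle_of_tag hwt)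
      rw [Phase.invocation_of_message c₁ hwm] at hw2
      have hw3 := (Option.some.inj hw2).symm
      have hwtag : E.OpTag (E.lastInv c₁ n₁) t := ⟨c₁, n₁, rfl, hwt⟩
      generalize hwdef : E.lastInv c₁ n₁ = w at *
      have hwn : E.opKey w < E.opKey n := by
        refine (hwtag.opKey_lt_iff hnt).2 (Or.inr ⟨rfl, Or.inl ⟨?_, c, hread⟩⟩)
        simp [hw3]
      have hwL : w ∈ L₁ := by
        have h1 : w ∈ L := (hL w).2 ⟨by omega, t, hwtag⟩
        rw [hL₁] at h1
        rcases List.mem_append.1 h1 with h1 | h1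
        · exact h1
        · rcases List.mem_cons.1 h1 with h1 | h1
          · exact absurd hwn (h1 ▸ lt_irrefl _)
          · exact absurd hwn ((List.pairwise_cons.1 hs2).1 w h1).not_gt
      -- The write `w` of the tag `t` sets the value. A write listed between `w` and the read would
      -- also have tag `t`, hence be `w` itself.
      obtain ⟨A, B, rfl⟩ := List.append_of_mem hwL
      rw [List.foldl_append, List.foldl_cons, hw3]
      refine (foldl_apply_eq _ fun j hj c' m' h => ?_).symm
      have hjL : j ∈ A ++ w :: B := by simp [hj]
      have hwj : E.opKey w < E.opKey j :=
        (List.pairwise_cons.1 (List.pairwise_append.1 hs1).2.1).1 j hj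
      obtain ⟨u, hu, hut⟩ := htag j hjL
      have htu : t ≤ u := by
        rcases (hwtag.opKey_lt_iff hu).1 hwj with h | ⟨h, -⟩
        exacts [h.le, h.le]
      obtain rfl := le_antisymm hut htu
      obtain ⟨c₂, i, rfl, h2⟩ := hu
      have := (write_tag_injective hwt hwm h2 (message_of_invWrite h2 h)).2.1
      rw [this, hwdef] at hwj
      exact lt_irrefl _ hwj

end Execution

end CAS

/-! ### Robustness of the algorithm -/

theorem mainTheorem6 {N k : ℕ} [NeZero k] (f e : ℕ) (hk : k ≤ N - 2 * (f + e))
    {K : Type*} [Field K] [Finite K] (α : Fin N → K) (hα : Function.Injective α)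
    (C : Type*) [LinearOrder C] (m₀ : Fin k → K) :
    CAS.Robust C α e m₀ f e ∧
    ∀ (M : Finset (Fin N)) (E : CAS.Execution C α e m₀ M), M.card ≤ e → E.CrashesAtMost f →
      ∀ n c v, E.act n = .retRead c v →
        ∃ t m, ((E.state n).client c).phase = .rFin t ∧ E.Finalized n t m ∧
          k + 2 * e ≤ CAS.numReceived (((E.state n).client c).shares t) ∧
          CAS.numCorrupted α m (((E.state n).client c).shares t) ≤ e ∧
          CAS.berlekampWelch α k e (((E.state n).client c).shares t) = some m ∧
          v = some (CAS.secret m) := by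
  -- As `k` is positive, the truncated subtraction in `hk` is a true one.
  have hN : k + 2 * (f + e) ≤ N := by
    have := NeZero.pos k
    omega
  exact ⟨fun M E hM hf => ⟨E.linearizableUpTo hα hM, fun hE => hE.live hf hN⟩,
    fun M E hM _ n c v h => E.read_spec hα hM h⟩
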